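/- Let $\hbar\in\mathbb C$ be such that $q:=e^{\hbar}$ is not a root of unity (so $\sinh\hbar\neq 0$). Let $\widetilde U(\mathfrak{sl}_2)_\hbar$ be the universal Arens–Michael algebra (complete Hausdorff unital topological $\mathbb C$-algebra whose topology is given by submultiplicative seminorms) generated by $E,F,H$ subject to $$[H,E]=2E,\qquad [H,F]=-2F,\qquad [E,F]=\frac{\sinh \hbar H}{\sinh\hbar}.$$ A continuous representation of $\widetilde U(\mathfrak{sl}_2)_\hbar$ on a complex Banach space $V$ is a continuous unital homomorphism to the Banach algebra of bounded operators on $V$; it is irreducible if $V\ne 0$ and $V$ has no invariant linear subspaces (closed or not) other than $0$ and $V$; two representations are equivalent if they are intertwined by a topological linear isomorphism. For $m\in\mathbb Z$ put $[m]_q=\dfrac{q^m-q^{-m}}{q-q^{-1}}$. For $n\in\mathbb Z_{\ge 0}$, $k\in\mathbb Z$, $\varepsilon\in\{1,-1\}$ put $r_{k,1}=2k\pi i/\hbar$, $r_{k,-1}=(2k+1)\pi i/\hbar$, and let $T_{n,k,\varepsilon}$ be the continuous representation on $\mathbb C^{n+1}$ (with standard basis $e_0,\dots,e_n$) determined by $$E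 e_{j}=\varepsilon[n-j+1]_q\,e_{j-1}\ (1\le j\le n),\quad E e_0=0,\qquad F e_{j}=[j+1]_q\,e_{j+1}\ (0\le j<n),\quad F e_n=0,\qquad H e_j=(n-2j+r_{k,\varepsilon})\,e_j .$$ (A) Every representation $T_{n,k,\varepsilon}$ is irreducible. (B) If $T_{n,k,\varepsilon}$ and $T_{n',k',\varepsilon'}$ are equivalent, then $n=n'$, $k=k'$ and $\varepsilon=\varepsilon'$. (C) Every continuous irreducible representation of $\widetilde U(\mathfrak{sl}_2)_\hbar$ on a complex Banach space is finite dimensional and equivalent to some $T_{n,k,\varepsilon}$ with $n\in\mathbb Z_{\ge0}$, $k\in\mathbb Z$, $\varepsilon\in\{1,-1\}$. -/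

import Mathlib

open Filter Topology

noncomputable section

namespace AnalyticSl2

/-! ### Arens-Michael algebras -/

/-- A seminorm `p` on a complex algebra is submultiplicative if `p (a b) ≤ p a * p b`. -/
def Submultiplicative {B : Type*} [Ring B] [Algebra ℂ B] (p : Seminorm ℂ B) : Prop :=
  ∀ a b : B, p (a * b) ≤ p a * p b

/-- An Arens-Michael algebra: a complete Hausdorff topological algebra over `ℂ` (unital and
associative) whose topology is determined by a system of submultiplicative seminorms. -/
structure IsArensMichael (B : Type*) [Ring B] [Algebra ℂ B] [UniformSpace B] : Prop where
  isUniformAddGroup : IsUniformAddGroup B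
  isTopologicalRing : IsTopologicalRing B
  complete : CompleteSpace B
  hausdorff : T2Space B
  seminorms : ∃ S : Set (Seminorm ℂ B), (∀ p ∈ S, Submultiplicative p) ∧
    WithSeminorms (fun p : S => (p : Seminorm ℂ B))

/-! ### The defining relations -/

/-- The `j`-th term `(sinh ħ)⁻¹ (ħ h)^(2j+1) / (2j+1)!` of the power series of
`sinh (ħ h) / sinh ħ`. -/
def sinhTerm (ħ : ℂ) {B : Type*} [Ring B] [Algebra ℂ B] (h : B) (j : ℕ) : B :=
  ((Complex.sinh ħ)⁻¹ * ((Nat.factorial (2 * j + 1) : ℂ))⁻¹) • (ħ • h) ^ (2 * j + 1)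

/-- The elements `e`, `f`, `h` of a topological algebra satisfy
`[h, e] = 2 e`, `[h, f] = -2 f`, `[e, f] = sinh (ħ h) / sinh ħ`,
where the right-hand side of the last relation is the sum of the convergent power series. -/
structure IsTriple (ħ : ℂ) {B : Type*} [Ring B] [Algebra ℂ B] [TopologicalSpace B]
    (e f h : B) : Prop where
  comm_h_e : h * e - e * h = (2 : ℂ) • e
  comm_h_f : h * f - f * h = (-2 : ℂ) • f
  comm_e_f : HasSum (sinhTerm ħ h) (e * f - f * e)

/-! ### The universal Arens-Michael algebra with these relations -/

/-- Names of the three generators. -/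
inductive Gen : Type
  | E : Gen
  | F : Gen
  | H : Gen

/-- The free associative unital complex algebra on three generators; the parameter `ħ` only
serves to attach the topology below. -/
def FreeAlg (_ħ : ℂ) : Type := FreeAlgebra ℂ Gen

instance (ħ : ℂ) : Ring (FreeAlg ħ) := inferInstanceAs (Ring (FreeAlgebra ℂ Gen))

instance (ħ : ℂ) : Algebra ℂ (FreeAlg ħ) := inferInstanceAs (Algebra ℂ (FreeAlgebra ℂ Gen))

/-- The generators of the free algebra. -/
def gen (ħ : ℂ) (x : Gen) : FreeAlg ħ := FreeAlgebra.ι ℂ x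

/-- The homomorphism from the free algebra given by the images of the generators. -/
def freeLift (ħ : ℂ) {B : Type*} [Ring B] [Algebra ℂ B] (g : Gen → B) : FreeAlg ħ →ₐ[ℂ] B :=
  FreeAlgebra.lift ℂ g

/-- The submultiplicative seminorms `p` on the free algebra for which the relations
`[H, E] = 2 E`, `[H, F] = -2 F`, `[E, F] = sinh (ħ H) / sinh ħ` hold "modulo `p`". -/
def admissible (ħ : ℂ) : Set (Seminorm ℂ (FreeAlg ħ)) :=
  {p | Submultiplicative p ∧
    p (gen ħ .H * gen ħ .E - gen ħ .E * gen ħ .H - (2 : ℂ) • gen ħ .E) = 0 ∧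
    p (gen ħ .H * gen ħ .F - gen ħ .F * gen ħ .H - (-2 : ℂ) • gen ħ .F) = 0 ∧
    Tendsto (fun s : Finset ℕ =>
      p (∑ j ∈ s, sinhTerm ħ (gen ħ .H) j - (gen ħ .E * gen ħ .F - gen ħ .F * gen ħ .E)))
      atTop (𝓝 0)}

/-- The system of all admissible seminorms. -/
def seminormFamily (ħ : ℂ) : SeminormFamily ℂ (FreeAlg ħ) (admissible ħ) := fun p => p.1

/-- The topology on the free algebra determined by all admissible seminorms. -/
instance (ħ : ℂ) : TopologicalSpace (FreeAlg ħ) := (seminormFamily ħ).moduleFilterBasis.topology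

theorem withSeminorms_freeAlg (ħ : ℂ) : WithSeminorms (seminormFamily ħ) := ⟨rfl⟩

theorem continuous_admissible (ħ : ℂ) (p : admissible ħ) :
    Continuous (p.1 : FreeAlg ħ → ℝ) :=
  (withSeminorms_freeAlg ħ).continuous_seminorm p

instance (ħ : ℂ) : IsTopologicalAddGroup (FreeAlg ħ) :=
  (withSeminorms_freeAlg ħ).topologicalAddGroup

instance (ħ : ℂ) : ContinuousSMul ℂ (FreeAlg ħ) := (withSeminorms_freeAlg ħ).continuousSMul

instance (ħ : ℂ) : IsTopologicalRing (FreeAlg ħ) where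
  continuous_mul := by
    rw [continuous_iff_continuousAt]
    rintro ⟨a, b⟩
    refine ((withSeminorms_freeAlg ħ).tendsto_nhds _ _).2 fun p ε hε => ?_
    have hp : Continuous (p.1 : FreeAlg ħ → ℝ) := continuous_admissible ħ p
    have hc : Continuous fun x : FreeAlg ħ × FreeAlg ħ =>
        p.1 (x.1 - a) * p.1 x.2 + p.1 a * p.1 (x.2 - b) := by fun_prop
    have hlim := hc.tendsto (a, b)
    simp only [sub_self, map_zero, zero_mul, mul_zero, add_zero] at hlim
    filter_upwards [hlim.eventually (gt_mem_nhds hε)] with x hx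
    have hsub : x.1 * x.2 - a * b = (x.1 - a) * x.2 + a * (x.2 - b) := by noncomm_ring
    calc p.1 (x.1 * x.2 - a * b) ≤ p.1 ((x.1 - a) * x.2) + p.1 (a * (x.2 - b)) := by
          rw [hsub]; exact map_add_le_add _ _ _
      _ ≤ p.1 (x.1 - a) * p.1 x.2 + p.1 a * p.1 (x.2 - b) :=
          add_le_add (p.2.1 _ _) (p.2.1 _ _)
      _ < ε := hx

instance (ħ : ℂ) : UniformSpace (FreeAlg ħ) := IsTopologicalAddGroup.rightUniformSpace (FreeAlg ħ)

instance (ħ : ℂ) : IsUniformAddGroup (FreeAlg ħ) := isUniformAddGroup_of_addCommGroup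

instance (ħ : ℂ) : UniformContinuousConstSMul ℂ (FreeAlg ħ) :=
  uniformContinuousConstSMul_of_continuousConstSMul ℂ (FreeAlg ħ)

/-- The algebra `Ũ(sl₂)_ħ`: the Hausdorff completion of the free algebra on `E`, `F`, `H` with
respect to all submultiplicative seminorms that respect the relations
`[H, E] = 2 E`, `[H, F] = -2 F`, `[E, F] = sinh (ħ H) / sinh ħ`.
It is the universal Arens-Michael algebra generated by a triple that satisfies the relations;
see `isArensMichael_USl2`, `isTriple_USl2` and `existsUnique_lift` below. -/
abbrev USl2 (ħ : ℂ) : Type := UniformSpace.Completion (FreeAlg ħ)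

/-- The canonical map from the free algebra to its completion. -/
def toUSl2 (ħ : ℂ) (a : FreeAlg ħ) : USl2 ħ := (a : UniformSpace.Completion (FreeAlg ħ))

/-- The generator `E`. -/
def genE (ħ : ℂ) : USl2 ħ := toUSl2 ħ (gen ħ .E)

/-- The generator `F`. -/
def genF (ħ : ℂ) : USl2 ħ := toUSl2 ħ (gen ħ .F)

/-- The generator `H`. -/
def genH (ħ : ℂ) : USl2 ħ := toUSl2 ħ (gen ħ .H)

theorem isTriple_freeAlg_mod (ħ : ℂ) :
    Inseparable (gen ħ .H * gen ħ .E - gen ħ .E * gen ħ .H) ((2 : ℂ) • gen ħ .E) ∧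
    Inseparable (gen ħ .H * gen ħ .F - gen ħ .F * gen ħ .H) ((-2 : ℂ) • gen ħ .F) ∧
    HasSum (sinhTerm ħ (gen ħ .H)) (gen ħ .E * gen ħ .F - gen ħ .F * gen ħ .E) := by
  have key : ∀ a b : FreeAlg ħ, (∀ p : admissible ħ, p.1 (a - b) = 0) → Inseparable a b := by
    intro a b hab
    refine Specializes.inseparable (specializes_iff_pure.2 (?_ : Tendsto id (pure a) (𝓝 b)))
    refine ((withSeminorms_freeAlg ħ).tendsto_nhds _ _).2 fun p ε hε => ?_
    rw [eventually_pure]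
    exact (hab p).trans_lt hε
  refine ⟨key _ _ fun p => p.2.2.1, key _ _ fun p => p.2.2.2.1, ?_⟩
  refine ((withSeminorms_freeAlg ħ).tendsto_nhds _ _).2 fun p ε hε => ?_
  exact p.2.2.2.2.eventually (gt_mem_nhds hε)

/-- The canonical map as a continuous algebra homomorphism. -/
def toUSl2Hom (ħ : ℂ) : FreeAlg ħ →A[ℂ] USl2 ħ where
  toFun := toUSl2 ħ
  map_one' := UniformSpace.Completion.coe_one _
  map_mul' := UniformSpace.Completion.coe_mul
  map_zero' := UniformSpace.Completion.coe_zero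
  map_add' := UniformSpace.Completion.coe_add
  commutes' := fun _ => rfl
  cont := UniformSpace.Completion.continuous_coe _

theorem map_sinhTerm (ħ : ℂ) {A B : Type*} [Ring A] [Algebra ℂ A] [Ring B] [Algebra ℂ B]
    (φ : A →ₐ[ℂ] B) (h : A) (j : ℕ) : φ (sinhTerm ħ h j) = sinhTerm ħ (φ h) j := by
  simp [sinhTerm]

theorem IsTriple.map {ħ : ℂ} {A B : Type*} [Ring A] [Algebra ℂ A] [TopologicalSpace A]
    [Ring B] [Algebra ℂ B] [TopologicalSpace B] {e f h : A} (t : IsTriple ħ e f h)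
    (φ : A →ₐ[ℂ] B) (hφ : Continuous φ) : IsTriple ħ (φ e) (φ f) (φ h) where
  comm_h_e := by simpa using congrArg φ t.comm_h_e
  comm_h_f := by simpa using congrArg φ t.comm_h_f
  comm_e_f := by
    have := t.comm_e_f.map φ hφ
    simpa [Function.comp_def, map_sinhTerm] using this

/-- The generators of `Ũ(sl₂)_ħ` satisfy the defining relations. -/
theorem isTriple_USl2 (ħ : ℂ) : IsTriple ħ (genE ħ) (genF ħ) (genH ħ) := by
  obtain ⟨h1, h2, h3⟩ := isTriple_freeAlg_mod ħ
  have hc : Continuous (toUSl2Hom ħ) := (toUSl2Hom ħ).cont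
  have hg : ∀ x, toUSl2Hom ħ (gen ħ x) = toUSl2 ħ (gen ħ x) := fun _ => rfl
  refine ⟨?_, ?_, ?_⟩
  · simpa [hg, genE, genH] using (h1.map hc).eq
  · simpa [hg, genF, genH] using (h2.map hc).eq
  · have h4 : HasSum _ _ := h3.map (toUSl2Hom ħ) hc
    have h5 : ∀ j, toUSl2Hom ħ (sinhTerm ħ (gen ħ .H) j) = sinhTerm ħ (genH ħ) j :=
      fun j => map_sinhTerm ħ (toUSl2Hom ħ : FreeAlg ħ →ₐ[ℂ] USl2 ħ) _ j
    have h6 : HasSum (fun j => sinhTerm ħ (genH ħ) j)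
        (genE ħ * genF ħ - genF ħ * genE ħ) := by
      simpa only [Function.comp_def, h5, map_sub, map_mul, hg, genE, genF] using h4
    exact h6

/-- The continuous extension of an admissible seminorm to the completion, as a function. -/
def extFun (ħ : ℂ) (p : admissible ħ) : USl2 ħ → ℝ :=
  UniformSpace.Completion.extension (fun a : FreeAlg ħ => p.1 a)

theorem extFun_coe (ħ : ℂ) (p : admissible ħ) (a : FreeAlg ħ) :
    extFun ħ p (toUSl2Hom ħ a) = p.1 a :=
  UniformSpace.Completion.extension_coe (f := fun a : FreeAlg ħ => p.1 a)
    (Seminorm.uniformContinuous_of_continuousAt_zero (continuous_admissible ħ p).continuousAt) a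

theorem continuous_extFun (ħ : ℂ) (p : admissible ħ) : Continuous (extFun ħ p) :=
  UniformSpace.Completion.continuous_extension

theorem extFun_add_le (ħ : ℂ) (p : admissible ħ) (x y : USl2 ħ) :
    extFun ħ p (x + y) ≤ extFun ħ p x + extFun ħ p y := by
  have hc := continuous_extFun ħ p
  refine UniformSpace.Completion.induction_on₂ x y
    (isClosed_le (by fun_prop) (by fun_prop)) fun a b => ?_
  have := map_add_le_add p.1 a b
  rwa [← extFun_coe, ← extFun_coe, ← extFun_coe, map_add] at this

theorem extFun_mul_le (ħ : ℂ) (p : admissible ħ) (x y : USl2 ħ) :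
    extFun ħ p (x * y) ≤ extFun ħ p x * extFun ħ p y := by
  have hc := continuous_extFun ħ p
  refine UniformSpace.Completion.induction_on₂ x y
    (isClosed_le (by fun_prop) (by fun_prop)) fun a b => ?_
  have := p.2.1 a b
  rwa [← extFun_coe, ← extFun_coe, ← extFun_coe, map_mul] at this

theorem extFun_smul (ħ : ℂ) (p : admissible ħ) (c : ℂ) (x : USl2 ħ) :
    extFun ħ p (c • x) = ‖c‖ * extFun ħ p x := by
  have hc := continuous_extFun ħ p
  have hs : Continuous fun y : USl2 ħ => c • y := continuous_const_smul c
  refine UniformSpace.Completion.induction_on x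
    (isClosed_eq (hc.comp hs) (by fun_prop)) fun a => ?_
  have := map_smul_eq_mul p.1 c a
  rwa [← extFun_coe, ← extFun_coe, map_smul] at this

/-- Extension of an admissible seminorm to the completion. -/
def extSeminorm (ħ : ℂ) (p : admissible ħ) : Seminorm ℂ (USl2 ħ) :=
  Seminorm.of (extFun ħ p) (extFun_add_le ħ p) (extFun_smul ħ p)

theorem extSeminorm_coe (ħ : ℂ) (p : admissible ħ) (a : FreeAlg ħ) :
    extSeminorm ħ p (toUSl2 ħ a) = p.1 a := extFun_coe ħ p a

theorem continuous_extSeminorm (ħ : ℂ) (p : admissible ħ) :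
    Continuous (extSeminorm ħ p : USl2 ħ → ℝ) := continuous_extFun ħ p

theorem submultiplicative_extSeminorm (ħ : ℂ) (p : admissible ħ) :
    Submultiplicative (extSeminorm ħ p) := extFun_mul_le ħ p

theorem withSeminorms_USl2 (ħ : ℂ) : WithSeminorms (extSeminorm ħ) := by
  refine (SeminormFamily.withSeminorms_iff_nhds_eq_iInf _).2 (le_antisymm ?_ ?_)
  · refine le_iInf fun p => ?_
    rw [← tendsto_iff_comap]
    simpa using (continuous_extSeminorm ħ p).tendsto 0
  · have hb := (withSeminorms_freeAlg ħ).hasBasis_zero_ball.hasBasis_of_isDenseInducing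
      (UniformSpace.Completion.isDenseInducing_coe (α := FreeAlg ħ))
    rw [UniformSpace.Completion.coe_zero] at hb
    refine hb.ge_iff.2 ?_
    rintro ⟨s, r⟩ hr
    have hO : IsOpen (⋂ p ∈ s, {x : USl2 ħ | extSeminorm ħ p x < r}) :=
      isOpen_biInter_finset fun p _ =>
        isOpen_lt (continuous_extSeminorm ħ p) continuous_const
    have hmem : (⋂ p ∈ s, {x : USl2 ħ | extSeminorm ħ p x < r}) ∈
        ⨅ p, comap (extSeminorm ħ p) (𝓝 0) := by
      refine (biInter_finset_mem s).2 fun p _ => mem_iInf_of_mem p ?_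
      exact preimage_mem_comap (Iio_mem_nhds hr)
    refine mem_of_superset hmem ?_
    refine (UniformSpace.Completion.denseRange_coe (α := FreeAlg ħ)).open_subset_closure_inter hO
      |>.trans (closure_mono ?_)
    rintro _ ⟨hx, a, rfl⟩
    refine ⟨a, ?_, rfl⟩
    rw [Seminorm.ball_finset_sup_eq_iInter _ _ _ hr]
    simp only [Set.mem_iInter, Set.mem_ofPred_eq, Seminorm.mem_ball_zero] at hx ⊢
    intro p hp
    have := hx p hp
    rwa [show ((a : UniformSpace.Completion (FreeAlg ħ)) : USl2 ħ) = toUSl2 ħ a from rfl,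
      extSeminorm_coe] at this

/-- `Ũ(sl₂)_ħ` is an Arens-Michael algebra. -/
theorem isArensMichael_USl2 (ħ : ℂ) : IsArensMichael (USl2 ħ) where
  isUniformAddGroup := inferInstance
  isTopologicalRing := inferInstance
  complete := inferInstance
  hausdorff := inferInstance
  seminorms := by
    refine ⟨Set.range (extSeminorm ħ), ?_, ?_⟩
    · rintro _ ⟨p, rfl⟩
      exact submultiplicative_extSeminorm ħ p
    · have h := (SeminormFamily.withSeminorms_iff_nhds_eq_iInf _).1 (withSeminorms_USl2 ħ)
      refine (SeminormFamily.withSeminorms_iff_nhds_eq_iInf _).2 (h.trans ?_)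
      exact (iInf_range' (fun q : Seminorm ℂ (USl2 ħ) => comap q (𝓝 0)) (extSeminorm ħ)).symm

/-- Continuity of the homomorphism from the free algebra given by a triple. -/
theorem continuous_freeLift {ħ : ℂ} {B : Type*} [Ring B] [Algebra ℂ B] [UniformSpace B]
    (hB : IsArensMichael B) {e f h : B} (t : IsTriple ħ e f h) (φ : FreeAlg ħ →ₐ[ℂ] B)
    (hE : φ (gen ħ .E) = e) (hF : φ (gen ħ .F) = f) (hH : φ (gen ħ .H) = h) : Continuous φ := by
  obtain ⟨S, hS, hw⟩ := hB.seminorms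
  have := hw.topologicalAddGroup
  refine hw.continuous_of_continuous_comp φ.toLinearMap fun q => ?_
  have hq : Continuous (q.1 : B → ℝ) := hw.continuous_seminorm q
  have hmem : q.1.comp φ.toLinearMap ∈ admissible ħ := by
    refine ⟨fun a b => ?_, ?_, ?_, ?_⟩
    · simpa using hS q.1 q.2 (φ a) (φ b)
    · simp [hE, hH, t.comm_h_e]
    · simp [hF, hH, t.comm_h_f]
    · have h0 : Tendsto (fun s : Finset ℕ => ∑ j ∈ s, sinhTerm ħ h j - (e * f - f * e)) atTop
          (𝓝 0) := by
        have h1 : Tendsto (fun s : Finset ℕ => ∑ j ∈ s, sinhTerm ħ h j) atTop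
          (𝓝 (e * f - f * e)) := t.comm_e_f
        simpa using h1.sub_const (e * f - f * e)
      have h1 := (hq.tendsto 0).comp h0
      simpa [Function.comp_def, map_sinhTerm, hE, hF, hH] using h1
  exact continuous_admissible ħ ⟨_, hmem⟩

/-- The universal property: every triple that satisfies the relations in an Arens-Michael algebra
`B` is the image of the generators under a unique continuous homomorphism `Ũ(sl₂)_ħ → B`. -/
theorem existsUnique_lift {ħ : ℂ} {B : Type*} [Ring B] [Algebra ℂ B] [UniformSpace B]
    (hB : IsArensMichael B) {e f h : B} (t : IsTriple ħ e f h) :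
    ∃! φ : USl2 ħ →A[ℂ] B, φ (genE ħ) = e ∧ φ (genF ħ) = f ∧ φ (genH ħ) = h := by
  have := hB.isUniformAddGroup
  have := hB.isTopologicalRing
  have := hB.complete
  have := hB.hausdorff
  let g : Gen → B := fun x => match x with
    | .E => e
    | .F => f
    | .H => h
  let φ₀ : FreeAlg ħ →ₐ[ℂ] B := freeLift ħ g
  have hg : ∀ x, φ₀ (gen ħ x) = g x := fun x => FreeAlgebra.lift_ι_apply g x
  have hc : Continuous φ₀ := continuous_freeLift hB t φ₀ (hg .E) (hg .F) (hg .H)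
  have hext : ∀ a, UniformSpace.Completion.extensionHom (φ₀ : FreeAlg ħ →+* B) hc (toUSl2 ħ a)
      = φ₀ a := fun a => UniformSpace.Completion.extensionHom_coe _ hc a
  refine ⟨⟨⟨UniformSpace.Completion.extensionHom (φ₀ : FreeAlg ħ →+* B) hc, fun c => ?_⟩,
    UniformSpace.Completion.continuous_extension⟩, ⟨?_, ?_, ?_⟩, ?_⟩
  · exact (hext (algebraMap ℂ (FreeAlg ħ) c)).trans (φ₀.commutes c)
  · exact (hext _).trans (hg .E)
  · exact (hext _).trans (hg .F)
  · exact (hext _).trans (hg .H)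
  · rintro ψ ⟨hE, hF, hH⟩
    have h0 : (ψ : USl2 ħ →ₐ[ℂ] B).comp (toUSl2Hom ħ : FreeAlg ħ →ₐ[ℂ] USl2 ħ) = φ₀ := by
      refine FreeAlgebra.hom_ext (funext fun x => ?_)
      refine Eq.trans ?_ (hg x).symm
      cases x
      · exact hE
      · exact hF
      · exact hH
    refine ContinuousAlgHom.ext fun x => ?_
    refine UniformSpace.Completion.induction_on x
      (isClosed_eq ψ.cont UniformSpace.Completion.continuous_extension) fun a => ?_
    exact (DFunLike.congr_fun h0 a).trans (hext a).symm

/-- A Banach algebra is an Arens-Michael algebra. -/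
theorem isArensMichael_of_banach (B : Type*) [NormedRing B] [NormedAlgebra ℂ B]
    [CompleteSpace B] : IsArensMichael B where
  isUniformAddGroup := inferInstance
  isTopologicalRing := inferInstance
  complete := inferInstance
  hausdorff := inferInstance
  seminorms := by
    refine ⟨{normSeminorm ℂ B}, ?_, ?_⟩
    · rintro _ rfl a b
      exact norm_mul_le a b
    · have h := (SeminormFamily.withSeminorms_iff_nhds_eq_iInf _).1 (norm_withSeminorms ℂ B)
      refine (SeminormFamily.withSeminorms_iff_nhds_eq_iInf _).2 (h.trans ?_)
      simp

/-! ### Banach space representations -/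

/-- A continuous representation of `Ũ(sl₂)_ħ` on a Banach space `V`: a continuous unital
homomorphism into the Banach algebra of bounded operators on `V`. -/
abbrev BanachRep (ħ : ℂ) (V : Type*) [NormedAddCommGroup V] [NormedSpace ℂ V] : Type _ :=
  USl2 ħ →A[ℂ] (V →L[ℂ] V)

/-- A representation on `V` is irreducible if `V ≠ 0` and the only invariant linear subspaces
(closed or not) are `0` and `V`. -/
def IsIrreducible {ħ : ℂ} {V : Type*} [NormedAddCommGroup V] [NormedSpace ℂ V]
    (ρ : BanachRep ħ V) : Prop :=
  Nontrivial V ∧ ∀ W : Submodule ℂ V, (∀ a : USl2 ħ, ∀ v ∈ W, ρ a v ∈ W) → W = ⊥ ∨ W = ⊤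

/-- Two representations are equivalent if they are intertwined by a topological linear
isomorphism. -/
def Equivalent {ħ : ℂ} {V W : Type*} [NormedAddCommGroup V] [NormedSpace ℂ V]
    [NormedAddCommGroup W] [NormedSpace ℂ W] (ρ : BanachRep ħ V) (σ : BanachRep ħ W) : Prop :=
  ∃ S : V ≃L[ℂ] W, ∀ (a : USl2 ħ) (v : V), S (ρ a v) = σ a (S v)

/-! ### The representations `T_{n,k,ε}` -/

/-- The `q`-number `[m]_q = (q^m - q^(-m)) / (q - q^(-1))` for `q = e^ħ`. -/
def qNumber (ħ : ℂ) (m : ℤ) : ℂ :=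
  (Complex.exp ħ ^ m - Complex.exp ħ ^ (-m)) / (Complex.exp ħ - (Complex.exp ħ)⁻¹)

/-- The shift `r_{k,1} = 2kπi/ħ`, `r_{k,-1} = (2k+1)πi/ħ`. -/
def shift (ħ : ℂ) (k : ℤ) (ε : ℤˣ) : ℂ :=
  if ε = 1 then 2 * k * Real.pi * ħ⁻¹ * Complex.I else (2 * k + 1) * Real.pi * ħ⁻¹ * Complex.I

/-- The matrix `E_{n,ε}`: `ε [n]_q, ε [n-1]_q, …, ε [1]_q` above the diagonal. -/
def matE (ħ : ℂ) (n : ℕ) (ε : ℤˣ) : Matrix (Fin (n + 1)) (Fin (n + 1)) ℂ :=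
  Matrix.of fun i j =>
    if (j : ℕ) = i + 1 then ((ε : ℤ) : ℂ) * qNumber ħ ((n : ℤ) - (i : ℕ)) else 0

/-- The matrix `F_{n,ε}`, independent of `ε`: `[1]_q, [2]_q, …, [n]_q` below the diagonal. -/
def matF (ħ : ℂ) (n : ℕ) : Matrix (Fin (n + 1)) (Fin (n + 1)) ℂ :=
  Matrix.of fun i j => if (i : ℕ) = j + 1 then qNumber ħ (i : ℕ) else 0

/-- The matrix `H_{n,k,ε}`: diagonal with entries `n - 2i + r_{k,ε}`, `i = 0, …, n`. -/
def matH (ħ : ℂ) (n : ℕ) (k : ℤ) (ε : ℤˣ) : Matrix (Fin (n + 1)) (Fin (n + 1)) ℂ :=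
  Matrix.diagonal fun i => (n : ℂ) - 2 * (i : ℕ) + shift ħ k ε

/-- Matrices as bounded operators on column vectors. -/
def matOp (n : ℕ) : Matrix (Fin (n + 1)) (Fin (n + 1)) ℂ →ₐ[ℂ]
    ((Fin (n + 1) → ℂ) →L[ℂ] (Fin (n + 1) → ℂ)) :=
  AlgHom.ofLinearMap
    (LinearMap.toContinuousLinearMap.toLinearMap ∘ₗ (Matrix.toLin' (R := ℂ)).toLinearMap)
    (by ext; simp) (fun A B => by ext; simp [Matrix.toLin'_mul])

theorem matOp_apply (n : ℕ) (A : Matrix (Fin (n + 1)) (Fin (n + 1)) ℂ) (v : Fin (n + 1) → ℂ) :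
    matOp n A v = A.mulVec v := rfl

theorem exp_sub_exp_neg (ħ : ℂ) (m : ℤ) :
    Complex.exp ħ ^ m - Complex.exp ħ ^ (-m) = 2 * Complex.sinh (m * ħ) := by
  rw [← Complex.exp_int_mul, ← Complex.exp_int_mul, Complex.sinh]
  push_cast
  rw [neg_mul]
  ring

theorem qNumber_eq (ħ : ℂ) (m : ℤ) :
    qNumber ħ m = Complex.sinh (m * ħ) / Complex.sinh ħ := by
  have h1 := exp_sub_exp_neg ħ 1
  rw [zpow_one, zpow_neg_one, Int.cast_one, one_mul] at h1
  rw [qNumber, exp_sub_exp_neg, h1, mul_div_mul_left _ _ two_ne_zero]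

theorem qNumber_identity (ħ : ℂ) (hħ : Complex.sinh ħ ≠ 0) (a b : ℤ) :
    qNumber ħ a * qNumber ħ (b + 1) - qNumber ħ (a + 1) * qNumber ħ b = qNumber ħ (a - b) := by
  simp only [qNumber_eq]
  push_cast
  rw [add_mul, add_mul, sub_mul, one_mul, Complex.sinh_add, Complex.sinh_add, Complex.sinh_sub]
  field_simp
  ring

theorem sinh_add_shift (ħ : ℂ) (hħ : Complex.sinh ħ ≠ 0) (k : ℤ) (ε : ℤˣ) (z : ℂ) :
    Complex.sinh (ħ * (z + shift ħ k ε)) = ((ε : ℤ) : ℂ) * Complex.sinh (z * ħ) := by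
  have h0 : ħ ≠ 0 := by
    rintro rfl
    simp at hħ
  rw [mul_add, Complex.sinh_add, mul_comm ħ z]
  rcases Int.units_eq_one_or ε with rfl | rfl
  · have h : ħ * shift ħ k 1 = ((k : ℂ) * (2 * Real.pi)) * Complex.I := by
      rw [shift, if_pos rfl]
      field_simp
    have hs : Complex.sin ((k : ℂ) * (2 * Real.pi)) = 0 := by
      have := Complex.sin_int_mul_pi (k * 2)
      push_cast at this
      rwa [mul_assoc] at this
    rw [h, Complex.sinh_mul_I, Complex.cosh_mul_I, Complex.cos_int_mul_two_pi, hs]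
    simp
  · have h : ħ * shift ħ k (-1) = ((k : ℂ) * (2 * Real.pi) + Real.pi) * Complex.I := by
      rw [shift, if_neg (by decide)]
      field_simp
    have hs : Complex.sin ((k : ℂ) * (2 * Real.pi) + Real.pi) = 0 := by
      have := Complex.sin_int_mul_pi (k * 2 + 1)
      push_cast at this
      rwa [add_mul, one_mul, mul_assoc] at this
    rw [h, Complex.sinh_mul_I, Complex.cosh_mul_I, hs, Complex.cos_add_pi,
      Complex.cos_int_mul_two_pi]
    simp

theorem matE_mul_matF (ħ : ℂ) (n : ℕ) (ε : ℤˣ) :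
    matE ħ n ε * matF ħ n = Matrix.diagonal fun i : Fin (n + 1) =>
      ((ε : ℤ) : ℂ) * (qNumber ħ ((n : ℤ) - (i : ℕ)) * qNumber ħ ((i : ℕ) + 1)) := by
  ext i j
  rw [Matrix.mul_apply]
  by_cases hi : (i : ℕ) < n
  · rw [Finset.sum_eq_single ⟨i + 1, by omega⟩]
    · by_cases hij : i = j
      · subst hij
        simp [matE, matF, mul_assoc]
      · have : (i : ℕ) ≠ j := fun h => hij (Fin.ext h)
        simp [matE, matF, Matrix.diagonal_apply_ne _ hij, this]
    · intro b _ hb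
      have : (b : ℕ) ≠ i + 1 := fun h => hb (Fin.ext h)
      simp [matE, this]
    · simp
  · have hin : (i : ℕ) = n := by omega
    rw [Finset.sum_eq_zero]
    · by_cases hij : i = j
      · subst hij
        simp [hin, qNumber]
      · rw [Matrix.diagonal_apply_ne _ hij]
    · intro b _
      have : (b : ℕ) ≠ i + 1 := by omega
      simp [matE, this]

theorem matF_mul_matE (ħ : ℂ) (n : ℕ) (ε : ℤˣ) :
    matF ħ n * matE ħ n ε = Matrix.diagonal fun i : Fin (n + 1) =>
      ((ε : ℤ) : ℂ) * (qNumber ħ ((n : ℤ) - (i : ℕ) + 1) * qNumber ħ (i : ℕ)) := by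
  ext i j
  rw [Matrix.mul_apply]
  by_cases hi : 0 < (i : ℕ)
  · rw [Finset.sum_eq_single ⟨i - 1, by omega⟩]
    · by_cases hij : i = j
      · subst hij
        have h1 : (i : ℕ) = i - 1 + 1 := by omega
        have h2 : (n : ℤ) - ((i - 1 : ℕ) : ℤ) = (n : ℤ) - (i : ℕ) + 1 := by omega
        simp only [matE, matF, Matrix.of_apply, Matrix.diagonal_apply_eq, if_pos h1, h2]
        ring
      · have h1 : ¬ (j : ℕ) = i - 1 + 1 := fun h => hij (Fin.ext (by omega))
        simp [matE, matF, Matrix.diagonal_apply_ne _ hij, h1]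
    · intro b _ hb
      have : ¬ (i : ℕ) = b + 1 := fun h => hb (Fin.ext (by simp; omega))
      simp [matF, this]
    · simp
  · have hin : (i : ℕ) = 0 := by omega
    rw [Finset.sum_eq_zero]
    · by_cases hij : i = j
      · subst hij
        simp [hin, qNumber]
      · rw [Matrix.diagonal_apply_ne _ hij]
    · intro b _
      have : ¬ (i : ℕ) = b + 1 := by omega
      simp [matF, this]

theorem isTriple_mat (ħ : ℂ) (hħ : Complex.sinh ħ ≠ 0) (n : ℕ) (k : ℤ) (ε : ℤˣ) :
    IsTriple ħ (matE ħ n ε) (matF ħ n) (matH ħ n k ε) where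
  comm_h_e := by
    ext i j
    rw [Matrix.sub_apply, matH, Matrix.diagonal_mul, Matrix.mul_diagonal, Matrix.smul_apply,
      smul_eq_mul]
    by_cases h : (j : ℕ) = i + 1
    · rw [h]
      push_cast
      ring
    · simp [matE, h]
  comm_h_f := by
    ext i j
    rw [Matrix.sub_apply, matH, Matrix.diagonal_mul, Matrix.mul_diagonal, Matrix.smul_apply,
      smul_eq_mul]
    by_cases h : (i : ℕ) = j + 1
    · rw [h]
      push_cast
      ring
    · simp [matF, h]
  comm_e_f := by
    have hterm : ∀ j, sinhTerm ħ (matH ħ n k ε) j = Matrix.diagonal fun i : Fin (n + 1) =>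
        (Complex.sinh ħ)⁻¹ * ((ħ * ((n : ℂ) - 2 * (i : ℕ) + shift ħ k ε)) ^ (2 * j + 1) /
          (Nat.factorial (2 * j + 1) : ℂ)) := by
      intro j
      rw [sinhTerm, matH, ← Matrix.diagonal_smul, Matrix.diagonal_pow, ← Matrix.diagonal_smul]
      congr 1
      ext i
      simp only [Pi.smul_apply, Pi.pow_apply, smul_eq_mul]
      ring
    rw [matE_mul_matF, matF_mul_matE, Matrix.diagonal_sub]
    simp only [funext hterm]
    refine HasSum.matrix_diagonal (Pi.hasSum.2 fun i => ?_)
    have h1 := (Complex.hasSum_sinh (ħ * ((n : ℂ) - 2 * (i : ℕ) + shift ħ k ε))).mul_left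
      (Complex.sinh ħ)⁻¹
    refine (Eq.subst (motive := fun z : ℂ => HasSum _ z) ?_ h1 :)
    rw [← mul_sub, qNumber_identity ħ hħ, qNumber_eq, sinh_add_shift ħ hħ]
    push_cast
    rw [show (n : ℂ) - (i : ℕ) - (i : ℕ) = n - 2 * (i : ℕ) by ring]
    ring

theorem isTriple_op (ħ : ℂ) (hħ : Complex.sinh ħ ≠ 0) (n : ℕ) (k : ℤ) (ε : ℤˣ) :
    IsTriple ħ (matOp n (matE ħ n ε)) (matOp n (matF ħ n)) (matOp n (matH ħ n k ε)) :=
  (isTriple_mat ħ hħ n k ε).map (matOp n)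
    (matOp n).toLinearMap.continuous_of_finiteDimensional

/-- The representation `T_{n,k,ε}` on `ℂ^(n+1)`: the unique continuous homomorphism with
`E ↦ E_{n,ε}`, `F ↦ F_{n,ε}`, `H ↦ H_{n,k,ε}`. -/
def repT (ħ : ℂ) (hħ : Complex.sinh ħ ≠ 0) (n : ℕ) (k : ℤ) (ε : ℤˣ) :
    BanachRep ħ (Fin (n + 1) → ℂ) :=
  (existsUnique_lift (isArensMichael_of_banach _) (isTriple_op ħ hħ n k ε)).choose

theorem repT_spec (ħ : ℂ) (hħ : Complex.sinh ħ ≠ 0) (n : ℕ) (k : ℤ) (ε : ℤˣ) :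
    repT ħ hħ n k ε (genE ħ) = matOp n (matE ħ n ε) ∧
    repT ħ hħ n k ε (genF ħ) = matOp n (matF ħ n) ∧
    repT ħ hħ n k ε (genH ħ) = matOp n (matH ħ n k ε) :=
  (existsUnique_lift (isArensMichael_of_banach _) (isTriple_op ħ hħ n k ε)).choose_spec.1

/-- If `e^ħ` is not a root of unity, then `sinh ħ ≠ 0`. -/
theorem sinh_ne_zero {ħ : ℂ} (hq : ∀ m : ℕ, m ≠ 0 → Complex.exp ħ ^ m ≠ 1) :
    Complex.sinh ħ ≠ 0 := by
  intro h
  have h1 := exp_sub_exp_neg ħ 1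
  rw [zpow_one, zpow_neg_one, Int.cast_one, one_mul, h, mul_zero, sub_eq_zero] at h1
  refine hq 2 two_ne_zero ?_
  rw [sq]
  nth_rewrite 2 [h1]
  exact mul_inv_cancel₀ (Complex.exp_ne_zero ħ)

end AnalyticSl2

end

open Filter Topology

noncomputable section

namespace AnalyticSl2

/-! ### Elements of a Banach algebra with `[h, x] = c x` -/

section Banach

variable {A : Type*} [NormedRing A] [NormedAlgebra ℂ A]

/-! The heart is (C). In a Banach algebra `[h, x] = c x` with `c ≠ 0` forces `x` to be nilpotent
(`isNilpotent_of_commutator`), so `E` and `F` act nilpotently. With `K = exp (ħ H)` the third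
relation reads `[E, F] = (K - K⁻¹) / (2 sinh ħ)`, which leads to a formula for `[E, F^(m+1)]`
(`IsTriple.commutator_e_pow_f`). Take the least power `F^(n+1)` that kills some nonzero `u` in `ker
E`. The formula and minimality give `K² u = q^(2n) u`, so `exp (2ħ(H - n))` fixes `u`.

Since `V` may be infinite dimensional, an eigenvector of `H` still has to be produced;
`exists_eigenvector_of_exp_apply_eq` does this inside `ker E ⊓ ker F^(n+1)`, with eigenvalue `n +
jπi/ħ`, and these numbers are exactly the `n + r_{k,ε}`. The divided powers `F^j w / [j]_q!` of this
highest weight vector define a nonzero intertwiner from `T_{n,k,ε}`, bijective by Schur's lemma.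

For (A), `E` drives any nonzero vector to a multiple of `e_0` and `F` regenerates the basis, all
coefficients being nonzero. For (B), the dimension gives `n`, and the `H`-eigenvalue on `ker E`
gives `r_{k,ε}`. -/

theorem commutator_pow {h x : A} {c : ℂ} (hx : h * x - x * h = c • x) (m : ℕ) :
    h * x ^ m - x ^ m * h = (m * c) • x ^ m := by
  induction m with
  | zero => simp
  | succ m ih =>
    have : h * x ^ (m + 1) - x ^ (m + 1) * h =
        (h * x ^ m - x ^ m * h) * x + x ^ m * (h * x - x * h) := by
      rw [pow_succ]; noncomm_ring
    rw [this, ih, hx, smul_mul_assoc, mul_smul_comm, ← pow_succ, ← add_smul]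
    congr 1
    push_cast
    ring

/-- The commutator with `h` multiplies `x ^ m` by `m c`, yet has norm at most `2 ‖h‖ ‖x ^ m‖`; for
`m > 2 ‖h‖ / ‖c‖` this leaves only `x ^ m = 0`. -/
theorem isNilpotent_of_commutator {h x : A} {c : ℂ} (hc : c ≠ 0)
    (hx : h * x - x * h = c • x) : IsNilpotent x := by
  obtain ⟨m, hm⟩ := exists_nat_gt (2 * ‖h‖ / ‖c‖)
  refine ⟨m, ?_⟩
  have hc' : 0 < ‖c‖ := norm_pos_iff.2 hc
  rw [div_lt_iff₀ hc'] at hm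
  have h1 : ‖((m : ℂ) * c) • x ^ m‖ ≤ ‖h‖ * ‖x ^ m‖ + ‖x ^ m‖ * ‖h‖ := by
    rw [← commutator_pow hx]
    exact (norm_sub_le _ _).trans (add_le_add (norm_mul_le _ _) (norm_mul_le _ _))
  rw [norm_smul, norm_mul, Complex.norm_natCast] at h1
  by_contra h0
  have h2 : 0 < ‖x ^ m‖ := norm_pos_iff.2 h0
  nlinarith

theorem exp_smul_one (c : ℂ) : NormedSpace.exp (c • (1 : A)) = Complex.exp c • (1 : A) := by
  rw [← Algebra.algebraMap_eq_smul_one, ← Algebra.algebraMap_eq_smul_one, Complex.exp_eq_exp_ℂ,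
    NormedSpace.algebraMap_exp_comm]

variable [CompleteSpace A]

theorem exp_add_smul_one (a : A) (c : ℂ) :
    NormedSpace.exp (a + c • (1 : A)) = Complex.exp c • NormedSpace.exp a := by
  let := NormedAlgebra.restrictScalars ℚ ℂ A
  rw [NormedSpace.exp_add_of_commute ((Commute.one_right a).smul_right c), exp_smul_one,
    mul_smul_comm, mul_one]

/-- The hypothesis says `x (h + c) = h x`, so `x` also intertwines the exponentials of `h + c` and
`h`. -/
theorem exp_mul_of_commutator {h x : A} {c : ℂ} (hx : h * x - x * h = c • x) :
    NormedSpace.exp h * x = Complex.exp c • (x * NormedSpace.exp h) := by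
  let := NormedAlgebra.restrictScalars ℚ ℂ A
  have h1 : SemiconjBy x (h + c • (1 : A)) h := by
    rw [SemiconjBy, mul_add, mul_smul_comm, mul_one, ← hx]
    abel
  have h2 := h1.exp_right
  rw [exp_add_smul_one, SemiconjBy, mul_smul_comm] at h2
  exact h2.symm

theorem exp_mul_of_commutator_smul {h x : A} {c : ℂ} (hx : h * x - x * h = c • x) (t : ℂ) :
    NormedSpace.exp (t • h) * x = Complex.exp (t * c) • (x * NormedSpace.exp (t • h)) :=
  exp_mul_of_commutator (by rw [smul_mul_assoc, mul_smul_comm, ← smul_sub, hx, smul_smul])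

theorem exp_mul_exp_neg (a : A) : NormedSpace.exp a * NormedSpace.exp (-a) = 1 := by
  let := NormedAlgebra.restrictScalars ℚ ℂ A
  rw [← NormedSpace.exp_add_of_commute ((Commute.refl a).neg_right), add_neg_cancel,
    NormedSpace.exp_zero]

/-- In `exp a - exp (-a)` the even terms cancel and the odd ones double; the sum is then reindexed
along `j ↦ 2 j + 1`. -/
theorem hasSum_sinhTerm (ħ : ℂ) (h : A) :
    HasSum (sinhTerm ħ h) ((2 * Complex.sinh ħ)⁻¹ •
      (NormedSpace.exp (ħ • h) - NormedSpace.exp (-(ħ • h)))) := by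
  have h1 := ((NormedSpace.exp_series_hasSum_exp' (𝕂 := ℂ) (ħ • h)).sub
    (NormedSpace.exp_series_hasSum_exp' (𝕂 := ℂ) (-(ħ • h)))).const_smul (2 * Complex.sinh ħ)⁻¹
  have hinj : Function.Injective fun j : ℕ => 2 * j + 1 := fun a b hab => by
    simp only at hab; omega
  rw [← hinj.hasSum_iff] at h1
  · refine h1.congr_fun ?_ |> fun h => h
    intro j
    have : (-(ħ • h)) ^ (2 * j + 1) = -(ħ • h) ^ (2 * j + 1) := Odd.neg_pow ⟨j, rfl⟩ _
    simp only [Function.comp, this, smul_neg, sub_neg_eq_add, sinhTerm, ← two_smul ℂ, smul_smul]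
    congr 1
    rw [mul_inv]
    ring
  · intro m hm
    have hm' : Even m := by
      by_contra h0
      obtain ⟨j, rfl⟩ := Nat.not_even_iff_odd.1 h0
      exact hm ⟨j, rfl⟩
    simp [hm'.neg_pow]

theorem IsTriple.commutator_e_f {ħ : ℂ} {e f h : A} (t : IsTriple ħ e f h) :
    e * f - f * e = (2 * Complex.sinh ħ)⁻¹ •
      (NormedSpace.exp (ħ • h) - NormedSpace.exp (-(ħ • h))) :=
  t.comm_e_f.unique (hasSum_sinhTerm ħ h)

end Banach

/-! ### Eigenvectors of operators whose exponential fixes a vector -/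

section Exponential

variable {V : Type*} [NormedAddCommGroup V] [NormedSpace ℂ V]

/-- Peel off one root `z` at a time: either `u` is an eigenvector for `z`, or `(X - z) u` is a
nonzero vector of `W` killed by the remaining factors. No finite dimensionality is needed. -/
theorem exists_eigenvector_of_prod_apply_eq_zero (X : Module.End ℂ V) (W : Submodule ℂ V)
    (hW : ∀ v ∈ W, X v ∈ W) (s : Multiset ℂ) {u : V} (hu : u ∈ W) (hu0 : u ≠ 0)
    (hs : Polynomial.aeval X (s.map fun z => Polynomial.X - Polynomial.C z).prod u = 0) :
    ∃ z ∈ s, ∃ w ∈ W, w ≠ 0 ∧ X w = z • w := by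
  induction s using Multiset.induction_on generalizing u with
  | empty => simp [hu0] at hs
  | cons z s ih =>
    by_cases h0 : X u = z • u
    · exact ⟨z, by simp, u, hu, hu0, h0⟩
    · rw [Multiset.map_cons, Multiset.prod_cons, mul_comm, map_mul, Module.End.mul_apply] at hs
      obtain ⟨y, hy, w, hw⟩ := ih (u := X u - z • u) (W.sub_mem (hW u hu) (W.smul_mem z hu))
        (sub_ne_zero.2 h0) (by simpa [Module.algebraMap_end_apply] using hs)
      exact ⟨y, by simp [hy], w, hw⟩

theorem exists_eigenvector_of_pow_apply_eq (X : Module.End ℂ V) (W : Submodule ℂ V)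
    (hW : ∀ v ∈ W, X v ∈ W) {m : ℕ} (hm : 0 < m) {u : V} (hu : u ∈ W) (hu0 : u ≠ 0)
    (hX : (X ^ m) u = u) : ∃ z : ℂ, z ^ m = 1 ∧ ∃ w ∈ W, w ≠ 0 ∧ X w = z • w := by
  have hs : (Polynomial.X ^ m - 1 : Polynomial ℂ) =
      ((Polynomial.nthRootsFinset m (1 : ℂ)).val.map fun z =>
        Polynomial.X - Polynomial.C z).prod :=
    Polynomial.X_pow_sub_one_eq_prod hm (Complex.isPrimitiveRoot_exp m hm.ne')
  obtain ⟨z, hz, w, hw⟩ := exists_eigenvector_of_prod_apply_eq_zero X W hW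
    (Polynomial.nthRootsFinset m (1 : ℂ)).val hu hu0 (by rw [← hs]; simp [hX])
  exact ⟨z, (Polynomial.mem_nthRootsFinset hm _).1 hz, w, hw⟩

variable [CompleteSpace V]

/-- The exponential series gives `-R w = ∑_{n ≥ 2} R^n w / n!`, whose norm is at most `‖R w‖ ∑_{n ≥
1} 3^(-n) = ‖R w‖ / 2`. -/
theorem apply_eq_zero_of_exp_apply_eq {R : V →L[ℂ] V} (hR : ‖R‖ ≤ 1 / 3) {w : V}
    (hw : NormedSpace.exp R w = w) : R w = 0 := by
  have h1 : HasSum (fun n : ℕ => ((n.factorial : ℂ)⁻¹ • R ^ n) w) w := by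
    have := (NormedSpace.exp_series_hasSum_exp' (𝕂 := ℂ) R).mapL (ContinuousLinearMap.apply ℂ V w)
    simpa [hw] using this
  rw [← hasSum_nat_add_iff' 2] at h1
  have h2 : HasSum (fun n : ℕ => (1 / 3 : ℝ) * (1 / 3) ^ n * ‖R w‖) (1 / 2 * ‖R w‖) := by
    have := ((hasSum_geometric_of_lt_one (r := (1 / 3 : ℝ)) (by norm_num) (by norm_num)).mul_left
      (1 / 3)).mul_right ‖R w‖
    rwa [show (1 / 3 : ℝ) * (1 - 1 / 3)⁻¹ = 1 / 2 by norm_num] at this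
  have h3 := h1.norm_le_of_bounded h2 fun n => by
    have hR' : (R ^ (n + 2)) w = (R ^ (n + 1)) (R w) := by rw [pow_succ R (n + 1)]; rfl
    rw [smul_apply, norm_smul, hR', norm_inv, Complex.norm_natCast]
    have h4 : ‖(R ^ (n + 1)) (R w)‖ ≤ (1 / 3) ^ (n + 1) * ‖R w‖ :=
      (ContinuousLinearMap.le_opNorm _ _).trans (mul_le_mul_of_nonneg_right
        ((norm_pow_le' R n.succ_pos).trans (pow_le_pow_left₀ (norm_nonneg _) hR _))
        (norm_nonneg _))
    have h5 : (((n + 2).factorial : ℝ))⁻¹ ≤ 1 :=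
      inv_le_one_of_one_le₀ (by exact_mod_cast Nat.factorial_pos _)
    calc _ ≤ 1 * ((1 / 3) ^ (n + 1) * ‖R w‖) :=
          mul_le_mul h5 h4 (norm_nonneg _) zero_le_one
      _ = _ := by ring
  simp only [Finset.sum_range_succ, Finset.sum_range_zero, Nat.factorial, Nat.cast_one, inv_one,
    pow_zero, pow_one, one_smul, zero_add, one_apply_eq_self, mul_one,
    sub_add_cancel_left, norm_neg] at h3
  have := norm_nonneg (R w)
  exact norm_eq_zero.1 (by linarith)

/-- If `exp T` fixes a nonzero vector of `W`, where `W` is invariant under all `exp (c T)`, then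
`W` contains an eigenvector of `T` with eigenvalue in `2πiℤ`. -/
theorem exists_eigenvector_of_exp_apply_eq (T : V →L[ℂ] V) (W : Submodule ℂ V)
    (hW : ∀ c : ℂ, ∀ v ∈ W, NormedSpace.exp (c • T) v ∈ W) {u : V} (hu : u ∈ W) (hu0 : u ≠ 0)
    (hT : NormedSpace.exp T u = u) :
    ∃ j : ℤ, ∃ w ∈ W, w ≠ 0 ∧ T w = ((j : ℂ) * (2 * Real.pi * Complex.I)) • w := by
  let := NormedAlgebra.restrictScalars ℚ ℂ (V →L[ℂ] V)
  have hlim : Tendsto (fun m : ℕ => ((m : ℂ)⁻¹) • T) atTop (𝓝 0) := by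
    have := (tendsto_inv_atTop_nhds_zero_nat (𝕜 := ℂ)).smul_const T
    simpa using this
  have hexp : Tendsto (fun m : ℕ => NormedSpace.exp (((m : ℂ)⁻¹) • T) - 1) atTop (𝓝 0) := by
    have := hlim.exp.sub_const (1 : V →L[ℂ] V)
    simpa using this
  have hlim' := hlim.norm
  have hexp' := hexp.norm
  rw [norm_zero] at hlim' hexp'
  -- The bound `1/9` on `exp R - 1` passes to `z - 1`, and becomes `3/2 * 1/9 = 1/6` for `log z`;
  -- with `‖R‖ < 1/6` this gives the `1/3` required for `R - log z`.
  obtain ⟨m, hm, h1, h2⟩ := ((eventually_gt_atTop 0).and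
    ((hlim'.eventually (gt_mem_nhds (show (0 : ℝ) < 1 / 6 by norm_num))).and
      (hexp'.eventually (gt_mem_nhds (show (0 : ℝ) < 1 / 9 by norm_num))))).exists
  have hm0 : (m : ℂ) ≠ 0 := by exact_mod_cast hm.ne'
  set R := ((m : ℂ)⁻¹) • T with hRdef
  have hRT : m • R = T := by
    rw [hRdef, ← Nat.cast_smul_eq_nsmul ℂ, smul_smul, mul_inv_cancel₀ hm0, one_smul]
  have hpow : NormedSpace.exp R ^ m = NormedSpace.exp T := by
    rw [← NormedSpace.exp_nsmul, hRT]
  -- As `(exp R)^m = exp T` fixes `u`, factoring `X^m - 1` yields an eigenvector of `exp R` in `W`.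
  obtain ⟨z, hz, w, hwW, hw0, hw⟩ := exists_eigenvector_of_pow_apply_eq
    (NormedSpace.exp R : V →L[ℂ] V).toLinearMap W (fun v hv => hW _ v hv) hm hu hu0 (by
      have : ((NormedSpace.exp R ^ m : V →L[ℂ] V)) u = u := by rw [hpow, hT]
      rwa [← ContinuousLinearMap.toLinearMap_pow])
  replace hw : NormedSpace.exp R w = z • w := hw
  have hwpos : 0 < ‖w‖ := norm_pos_iff.2 hw0
  have hz1 : ‖z - 1‖ ≤ 1 / 9 := by
    have h3 := (NormedSpace.exp R - 1 : V →L[ℂ] V).le_opNorm w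
    rw [sub_apply, hw, one_apply_eq_self] at h3
    have h4 : z • w - w = (z - 1) • w := by rw [sub_smul, one_smul]
    rw [h4, norm_smul] at h3
    exact (le_of_mul_le_mul_right h3 hwpos).trans h2.le
  have hzne : z ≠ 0 := by
    rintro rfl
    norm_num at hz1
  set b := Complex.log z with hb
  have hbz : Complex.exp b = z := Complex.exp_log hzne
  have hbn : ‖b‖ ≤ 1 / 6 := by
    have h3 := Complex.norm_log_one_add_half_le_self (z := z - 1) (by linarith)
    rw [add_sub_cancel, ← hb] at h3
    linarith
  -- `exp (R - b)` fixes `w` and `R - b` is small, so an eigenvector of the exponential is one of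
  -- `R` itself.
  have hR' : (R + (-b) • (1 : V →L[ℂ] V)) w = 0 := by
    refine apply_eq_zero_of_exp_apply_eq ?_ ?_
    · have h3 : ‖(-b) • (1 : V →L[ℂ] V)‖ ≤ 1 / 6 := by
        rw [norm_smul, norm_neg]
        calc ‖b‖ * ‖(1 : V →L[ℂ] V)‖ ≤ ‖b‖ * 1 :=
              mul_le_mul_of_nonneg_left ContinuousLinearMap.norm_id_le (norm_nonneg _)
          _ ≤ 1 / 6 := by linarith
      linarith [norm_add_le R ((-b) • (1 : V →L[ℂ] V))]
    · rw [exp_add_smul_one, smul_apply, hw, smul_smul, Complex.exp_neg, hbz,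
        inv_mul_cancel₀ hzne, one_smul]
  have hRw : R w = b • w := by
    have h3 : R w + (-b) • w = 0 := hR'
    rwa [neg_smul, ← sub_eq_add_neg, sub_eq_zero] at h3
  have hmb : Complex.exp (m * b) = 1 := by rw [Complex.exp_nat_mul, hbz, hz]
  obtain ⟨j, hj⟩ := Complex.exp_eq_one_iff.1 hmb
  refine ⟨j, w, hwW, hw0, ?_⟩
  rw [← hj, ← hRT, smul_apply, hRw, ← Nat.cast_smul_eq_nsmul ℂ, smul_smul]

end Exponential

/-! ### Highest weight vectors -/

/-- If `[m]_q = 0`, then `q^(2m) = 1`. -/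
theorem qNumber_ne_zero {ħ : ℂ} (hq : ∀ m : ℕ, m ≠ 0 → Complex.exp ħ ^ m ≠ 1) {m : ℤ}
    (hm : m ≠ 0) : qNumber ħ m ≠ 0 := by
  have h0 : ∀ m : ℤ, m ≠ 0 → Complex.exp ħ ^ m ≠ 1 := by
    intro m hm h
    refine hq m.natAbs (Int.natAbs_ne_zero.2 hm) ?_
    rcases Int.natAbs_eq m with h1 | h1
    · rwa [h1, zpow_natCast] at h
    · rwa [h1, zpow_neg, inv_eq_one, zpow_natCast] at h
  rw [qNumber_eq]
  refine div_ne_zero (fun h => ?_) (sinh_ne_zero hq)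
  have h1 := exp_sub_exp_neg ħ m
  rw [h, mul_zero, sub_eq_zero] at h1
  refine h0 (m + m) (by omega) ?_
  rw [zpow_add₀ (Complex.exp_ne_zero ħ)]
  nth_rewrite 2 [h1]
  rw [← zpow_add₀ (Complex.exp_ne_zero ħ), add_neg_cancel, zpow_zero]

/-- This is the identity between the coefficients of `exp (ħ h)` in the inductive step of
`IsTriple.commutator_e_pow_f`; replacing `ħ` by `-ħ` gives the one for `exp (-ħ h)`. -/
theorem qNumber_recursion (ħ : ℂ) (hħ : Complex.sinh ħ ≠ 0) (m : ℕ) :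
    Complex.exp (ħ * ((m + 1 : ℕ) * (-2))) + qNumber ħ (m + 1) * Complex.exp (-(m * ħ)) =
      qNumber ħ (m + 2) * Complex.exp (-((m + 1 : ℕ) * ħ)) := by
  have h1 : ħ * (((m + 1 : ℕ) : ℂ) * (-2)) = -(m * ħ) + -(m * ħ) + -ħ + -ħ := by
    push_cast; ring
  have h2 : -(((m + 1 : ℕ) : ℂ) * ħ) = -(m * ħ) + -ħ := by push_cast; ring
  have h3 : (((m : ℤ) + 1 : ℤ) : ℂ) * ħ = m * ħ + ħ := by push_cast; ring
  have h4 : (((m : ℤ) + 2 : ℤ) : ℂ) * ħ = m * ħ + ħ + ħ := by push_cast; ring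
  have hx := Complex.exp_ne_zero ħ
  have hy := Complex.exp_ne_zero (m * ħ)
  rw [qNumber_eq, qNumber_eq, div_mul_eq_mul_div, div_mul_eq_mul_div, eq_div_iff hħ, add_mul,
    div_mul_cancel₀ _ hħ, h1, h2, h3, h4]
  simp only [Complex.sinh, neg_add, Complex.exp_add, Complex.exp_neg]
  field_simp
  ring

theorem qNumber_neg_left (ħ : ℂ) (m : ℤ) : qNumber (-ħ) m = qNumber ħ m := by
  rw [qNumber_eq, qNumber_eq, mul_neg, Complex.sinh_neg, Complex.sinh_neg, neg_div_neg_eq]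

/-! ### The commutator of `e` with powers of `f` -/

section Banach

variable {A : Type*} [NormedRing A] [NormedAlgebra ℂ A] [CompleteSpace A]

/-- Induction on `m`: moving `exp (± ħ h)` to the right of `f ^ (m + 1)` costs the factor
`q^(∓2(m+1))`, and `qNumber_recursion` recombines the coefficients. -/
theorem IsTriple.commutator_e_pow_f {ħ : ℂ} (hħ : Complex.sinh ħ ≠ 0) {e f h : A}
    (t : IsTriple ħ e f h) (m : ℕ) :
    e * f ^ (m + 1) - f ^ (m + 1) * e =
      ((2 * Complex.sinh ħ)⁻¹ * qNumber ħ (m + 1)) • (f ^ m *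
        (Complex.exp (-(m * ħ)) • NormedSpace.exp (ħ • h) -
          Complex.exp (m * ħ) • NormedSpace.exp ((-ħ) • h))) := by
  have hef := t.commutator_e_f
  rw [← neg_smul] at hef
  induction m with
  | zero =>
    have : qNumber ħ 1 = 1 := by rw [qNumber_eq]; simp [hħ]
    simp [hef, this]
  | succ m ih =>
    have h1 : e * f ^ (m + 1 + 1) - f ^ (m + 1 + 1) * e =
        (e * f - f * e) * f ^ (m + 1) + f * (e * f ^ (m + 1) - f ^ (m + 1) * e) := by
      rw [pow_succ' f (m + 1)]; noncomm_ring
    have h2 := exp_mul_of_commutator_smul (commutator_pow t.comm_h_f (m + 1))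
    have hK := qNumber_recursion ħ hħ m
    have hK' : Complex.exp (-ħ * ((m + 1 : ℕ) * (-2))) + qNumber ħ (m + 1) * Complex.exp (m * ħ) =
        qNumber ħ (m + 2) * Complex.exp ((m + 1 : ℕ) * ħ) := by
      simpa only [qNumber_neg_left, mul_neg, neg_neg] using
        qNumber_recursion (-ħ) (by rwa [Complex.sinh_neg, neg_ne_zero]) m
    rw [h1, hef, ih, smul_mul_assoc, sub_mul, h2, h2, mul_smul_comm, ← mul_assoc f, ← pow_succ']
    simp only [mul_sub, mul_smul_comm, smul_sub, smul_smul]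
    rw [sub_add_sub_comm, ← add_smul, ← add_smul]
    congr 2
    · push_cast at hK ⊢
      rw [show (m : ℤ) + 1 + 1 = m + 2 by ring]
      linear_combination (2 * Complex.sinh ħ)⁻¹ * hK
    · push_cast at hK' ⊢
      rw [show (m : ℤ) + 1 + 1 = m + 2 by ring]
      linear_combination (2 * Complex.sinh ħ)⁻¹ * hK'

end Banach

/-! ### Existence of a highest weight vector -/

section Operators

variable {V : Type*} [NormedAddCommGroup V] [NormedSpace ℂ V] [CompleteSpace V]

/-- `x` commutes with `exp (s T)` up to a nonzero scalar, so `exp (s T)` preserves `ker x`. -/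
theorem apply_exp_smul_apply_eq_zero {T x : V →L[ℂ] V} {c : ℂ} (hx : T * x - x * T = c • x)
    (s : ℂ) {v : V} (hv : x v = 0) : x (NormedSpace.exp (s • T) v) = 0 := by
  have h1 := DFunLike.congr_fun (exp_mul_of_commutator_smul hx s) v
  have h2 : NormedSpace.exp (s • T) (x v) =
    Complex.exp (s * c) • x (NormedSpace.exp (s • T) v) := h1
  rw [hv, map_zero, eq_comm, smul_eq_zero] at h2
  exact h2.resolve_left (Complex.exp_ne_zero _)

omit [CompleteSpace V] in
theorem exists_apply_eq_zero_of_isNilpotent [Nontrivial V] {x : V →L[ℂ] V}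
    (hx : IsNilpotent x) : ∃ v, v ≠ 0 ∧ x v = 0 := by
  by_contra! h
  obtain ⟨m, hm⟩ := hx
  obtain ⟨v, hv⟩ := exists_ne (0 : V)
  have : ∀ m : ℕ, (x ^ m) v ≠ 0 := by
    intro m
    induction m with
    | zero => simpa
    | succ m ih =>
      rw [pow_succ']
      exact h _ ih
  exact this m (by simp [hm])

theorem shift_of_int (ħ : ℂ) (j : ℤ) : ∃ (k : ℤ) (ε : ℤˣ),
    (j : ℂ) * Real.pi * ħ⁻¹ * Complex.I = shift ħ k ε := by
  rcases Int.even_or_odd' j with ⟨k, rfl | rfl⟩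
  · exact ⟨k, 1, by simp [shift]⟩
  · exact ⟨k, -1, by rw [shift, if_neg (by decide)]; push_cast; rfl⟩

/-- A vector killed by `e` and by a minimal power `f ^ (n + 1)` is fixed by
`exp (2 ħ (h - n))`. -/
theorem IsTriple.exp_apply_eq_of_minimal {ħ : ℂ} (hq : ∀ m : ℕ, m ≠ 0 → Complex.exp ħ ^ m ≠ 1)
    {e f h : V →L[ℂ] V} (t : IsTriple ħ e f h) {n : ℕ}
    (hmin : ∀ v, e v = 0 → (f ^ n) v = 0 → v = 0) {u : V} (hu : e u = 0)
    (hfu : (f ^ (n + 1)) u = 0) :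
    NormedSpace.exp ((2 * ħ) • h + (-(2 * (n * ħ))) • (1 : V →L[ℂ] V)) u = u := by
  let := NormedAlgebra.restrictScalars ℚ ℂ (V →L[ℂ] V)
  have hħ := sinh_ne_zero hq
  set K := NormedSpace.exp (ħ • h) with hK
  set K' := NormedSpace.exp ((-ħ) • h) with hK'
  have hKK' : K * K' = 1 := by rw [hK, hK', neg_smul, exp_mul_exp_neg]
  have hKK : NormedSpace.exp ((2 * ħ) • h) = K * K := by
    rw [hK, ← NormedSpace.exp_add_of_commute (Commute.refl _), ← two_smul ℂ (ħ • h), smul_smul]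
  have h1 := DFunLike.congr_fun (t.commutator_e_pow_f hħ n) u
  have h2 : e ((f ^ (n + 1)) u) - (f ^ (n + 1)) (e u) =
      ((2 * Complex.sinh ħ)⁻¹ * qNumber ħ (n + 1)) • (f ^ n)
        (Complex.exp (-(n * ħ)) • K u - Complex.exp (n * ħ) • K' u) := h1
  rw [hu, hfu, map_zero, map_zero, sub_zero, eq_comm, smul_eq_zero] at h2
  have h3 := h2.resolve_left (mul_ne_zero (inv_ne_zero (mul_ne_zero two_ne_zero hħ))
    (qNumber_ne_zero hq (by omega)))
  -- The vector `q^(-n) K u - q^n K⁻¹ u` is killed by `f ^ n` and also by `e`, because `K` and `K⁻¹`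
  -- preserve `ker e`.
  have h4 := hmin _ (by
    rw [map_sub, map_smul, map_smul, apply_exp_smul_apply_eq_zero t.comm_h_e _ hu,
      apply_exp_smul_apply_eq_zero t.comm_h_e _ hu]
    simp) h3
  have h5 := congrArg K (sub_eq_zero.1 h4)
  have h6 : K (K' u) = u := DFunLike.congr_fun hKK' u
  rw [map_smul, map_smul, h6] at h5
  rw [exp_add_smul_one, hKK]
  change Complex.exp (-(2 * (n * ħ))) • K (K u) = u
  rw [two_mul, neg_add, Complex.exp_add, mul_smul, h5, smul_smul, ← Complex.exp_add,
    neg_add_cancel, Complex.exp_zero, one_smul]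

theorem IsTriple.exists_highest_weight [Nontrivial V] {ħ : ℂ}
    (hq : ∀ m : ℕ, m ≠ 0 → Complex.exp ħ ^ m ≠ 1) {e f h : V →L[ℂ] V} (t : IsTriple ħ e f h) :
    ∃ (n : ℕ) (k : ℤ) (ε : ℤˣ) (w : V), w ≠ 0 ∧ e w = 0 ∧ (f ^ (n + 1)) w = 0 ∧
      h w = ((n : ℂ) + shift ħ k ε) • w := by
  classical
  have h0 : ħ ≠ 0 := by
    rintro rfl
    exact hq 1 one_ne_zero (by simp)
  obtain ⟨N, hN⟩ := isNilpotent_of_commutator (by norm_num) t.comm_h_f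
  obtain ⟨v, hv0, hv⟩ := exists_apply_eq_zero_of_isNilpotent
    (isNilpotent_of_commutator two_ne_zero t.comm_h_e)
  -- The power of `f` is minimized over all nonzero vectors of `ker e` at once, so that minimality
  -- applies to vectors other than `u`.
  have hex : ∃ m : ℕ, ∃ v, v ≠ 0 ∧ e v = 0 ∧ (f ^ m) v = 0 := ⟨N, v, hv0, hv, by simp [hN]⟩
  obtain ⟨u, hu0, hu, hfu⟩ := Nat.find_spec hex
  obtain ⟨n, hn⟩ : ∃ n, Nat.find hex = n + 1 := by
    refine Nat.exists_eq_succ_of_ne_zero fun h => ?_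
    rw [h] at hfu
    exact hu0 (by simpa using hfu)
  rw [hn] at hfu
  have hmin : ∀ v, e v = 0 → (f ^ n) v = 0 → v = 0 := fun v h1 h2 => by
    by_contra h3
    exact Nat.find_min hex (m := n) (by omega) ⟨v, h3, h1, h2⟩
  set T := (2 * ħ) • h + (-(2 * (n * ħ))) • (1 : V →L[ℂ] V) with hT
  have hcomm : ∀ {x : V →L[ℂ] V} {c : ℂ}, h * x - x * h = c • x →
      T * x - x * T = (2 * ħ * c) • x := by
    intro x c hx
    rw [mul_smul, ← hx, hT]
    simp only [add_mul, mul_add, smul_mul_assoc, mul_smul_comm, one_mul, mul_one, smul_sub]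
    abel
  -- Commutation with `T = 2ħ(h - n)` rescales both `e` and `f ^ (n + 1)`, so the intersection of
  -- their kernels is stable under every `exp (c T)`.
  obtain ⟨j, w, ⟨hew, hfw⟩, hw0, hw⟩ := exists_eigenvector_of_exp_apply_eq T
    (LinearMap.ker e.toLinearMap ⊓ LinearMap.ker (f ^ (n + 1)).toLinearMap)
    (fun c v hv => ⟨apply_exp_smul_apply_eq_zero (hcomm t.comm_h_e) c hv.1,
      apply_exp_smul_apply_eq_zero (hcomm (commutator_pow t.comm_h_f (n + 1))) c hv.2⟩)
    ⟨hu, hfu⟩ hu0 (t.exp_apply_eq_of_minimal hq hmin hu hfu)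
  obtain ⟨k, ε, hk⟩ := shift_of_int ħ j
  refine ⟨n, k, ε, w, hw0, hew, hfw, ?_⟩
  have h1 : (2 * ħ) • h w + (-(2 * (n * ħ))) • w = ((j : ℂ) * (2 * Real.pi * Complex.I)) • w :=
    hw
  have h2 : h w = (2 * ħ)⁻¹ • ((2 * ħ) • h w + (-(2 * (n * ħ))) • w) + (n : ℂ) • w := by
    rw [smul_add, smul_smul, smul_smul, inv_mul_cancel₀ (by simpa using h0), one_smul, add_assoc,
      ← add_smul, left_eq_add]
    convert zero_smul ℂ w
    field_simp
    ring
  rw [h2, h1, ← hk, smul_smul, ← add_smul]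
  congr 1
  field_simp
  ring

end Operators

/-! ### Intertwining operators -/

section Intertwining

variable {ħ : ℂ} {V W : Type*} [NormedAddCommGroup V] [NormedSpace ℂ V]
  [NormedAddCommGroup W] [NormedSpace ℂ W]

/-- The condition is closed in `a`, so it suffices to check it on the dense image of the free
algebra, by induction on words. -/
theorem intertwines_of_generators (ρ : BanachRep ħ V) (σ : BanachRep ħ W) (S : V →L[ℂ] W)
    (hE : ∀ v, S (ρ (genE ħ) v) = σ (genE ħ) (S v))
    (hF : ∀ v, S (ρ (genF ħ) v) = σ (genF ħ) (S v))
    (hH : ∀ v, S (ρ (genH ħ) v) = σ (genH ħ) (S v)) (a : USl2 ħ) (v : V) :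
    S (ρ a v) = σ a (S v) := by
  suffices h : S.comp (ρ a) = (σ a).comp S from DFunLike.congr_fun h v
  have hρ : Continuous ρ := ρ.cont
  have hσ : Continuous σ := σ.cont
  refine UniformSpace.Completion.induction_on a
    (isClosed_eq (hρ.const_clm_comp S) (hσ.clm_comp_const S)) fun b => ?_
  have hfree : ∀ b : FreeAlg ħ, ∀ v, S (ρ (toUSl2Hom ħ b) v) = σ (toUSl2Hom ħ b) (S v) := by
    intro b
    refine FreeAlgebra.induction ℂ Gen
      (motive := fun b : FreeAlg ħ => ∀ v, S (ρ (toUSl2Hom ħ b) v) = σ (toUSl2Hom ħ b) (S v))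
      (fun r v => ?_) (fun x v => ?_) (fun x y hx hy v => ?_) (fun x y hx hy v => ?_) b
    · have h1 : toUSl2Hom ħ (algebraMap ℂ (FreeAlg ħ) r) = algebraMap ℂ (USl2 ħ) r := rfl
      have h2 : ρ (algebraMap ℂ (USl2 ħ) r) = algebraMap ℂ _ r := AlgHomClass.commutes ρ r
      have h3 : σ (algebraMap ℂ (USl2 ħ) r) = algebraMap ℂ _ r := AlgHomClass.commutes σ r
      change S (ρ (toUSl2Hom ħ (algebraMap ℂ (FreeAlg ħ) r)) v) =
        σ (toUSl2Hom ħ (algebraMap ℂ (FreeAlg ħ) r)) (S v)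
      rw [h1, h2, h3, Algebra.algebraMap_eq_smul_one, Algebra.algebraMap_eq_smul_one]
      exact map_smul S r v
    · cases x
      · exact hE v
      · exact hF v
      · exact hH v
    · have h1 : toUSl2Hom ħ (x * y) = toUSl2Hom ħ x * toUSl2Hom ħ y := map_mul (toUSl2Hom ħ) x y
      change S (ρ (toUSl2Hom ħ (x * y)) v) = σ (toUSl2Hom ħ (x * y)) (S v)
      rw [h1, map_mul, map_mul]
      exact (hx _).trans (congrArg _ (hy v))
    · have h1 : toUSl2Hom ħ (x + y) = toUSl2Hom ħ x + toUSl2Hom ħ y := map_add (toUSl2Hom ħ) x y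
      change S (ρ (toUSl2Hom ħ (x + y)) v) = σ (toUSl2Hom ħ (x + y)) (S v)
      rw [h1, map_add, map_add]
      exact (map_add S _ _).trans (congrArg₂ _ (hx v) (hy v))
  exact ContinuousLinearMap.ext (hfree b)

/-- Schur's lemma: a nonzero intertwiner of irreducible representations is bijective. -/
theorem bijective_of_intertwines {ρ : BanachRep ħ V} {σ : BanachRep ħ W}
    (hρ : IsIrreducible ρ) (hσ : IsIrreducible σ) {S : V →L[ℂ] W} (hS : S ≠ 0)
    (h : ∀ a v, S (ρ a v) = σ a (S v)) : Function.Bijective S := by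
  constructor
  · refine LinearMap.ker_eq_bot.1 ((hρ.2 (LinearMap.ker S.toLinearMap)
      fun a v hv => ?_).resolve_right fun h1 => hS ?_)
    · have hv' : S v = 0 := hv
      change S (ρ a v) = 0
      rw [h, hv', map_zero]
    · ext v
      exact (h1 ▸ Submodule.mem_top : v ∈ LinearMap.ker S.toLinearMap)
  -- The range need not be known to be closed, since irreducibility excludes all invariant linear
  -- subspaces.
  · refine LinearMap.range_eq_top.1 ((hσ.2 (LinearMap.range S.toLinearMap)
      fun a v hv => ?_).resolve_left fun h1 => hS ?_)
    · obtain ⟨x, rfl⟩ := hv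
      exact ⟨ρ a x, h a x⟩
    · ext v
      exact (h1 ▸ LinearMap.mem_range_self _ v : S v ∈ (⊥ : Submodule ℂ W))

end Intertwining

/-! ### The representations `T_{n,k,ε}` -/

section Matrices

variable (ħ : ℂ) (n : ℕ) (k : ℤ) (ε : ℤˣ)

theorem matE_mulVec_of_lt (v : Fin (n + 1) → ℂ) {i : ℕ} (hi : i < n) :
    (matE ħ n ε).mulVec v ⟨i, by omega⟩ =
      ((ε : ℤ) : ℂ) * qNumber ħ ((n : ℤ) - i) * v ⟨i + 1, by omega⟩ := by
  rw [Matrix.mulVec, dotProduct, Finset.sum_eq_single ⟨i + 1, by omega⟩]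
  · simp [matE]
  · intro b _ hb
    have : (b : ℕ) ≠ i + 1 := fun h => hb (Fin.ext h)
    simp [matE, this]
  · simp

theorem matE_mulVec_last (v : Fin (n + 1) → ℂ) : (matE ħ n ε).mulVec v (Fin.last n) = 0 := by
  rw [Matrix.mulVec, dotProduct, Finset.sum_eq_zero]
  intro b _
  have : (b : ℕ) ≠ n + 1 := by omega
  simp [matE, this]

theorem matE_mulVec_single_zero :
    (matE ħ n ε).mulVec (Pi.single 0 1) = 0 := by
  rw [Matrix.mulVec_single_one]
  ext i
  simp [matE]

theorem matE_mulVec_single_succ {j : ℕ} (hj : j < n) :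
    (matE ħ n ε).mulVec (Pi.single ⟨j + 1, by omega⟩ 1) =
      (((ε : ℤ) : ℂ) * qNumber ħ ((n : ℤ) - j)) • Pi.single ⟨j, by omega⟩ 1 := by
  rw [Matrix.mulVec_single_one]
  ext i
  by_cases h : (i : ℕ) = j
  · rw [show i = ⟨j, by omega⟩ from Fin.ext h]
    simp [matE]
  · have h1 : i ≠ ⟨j, by omega⟩ := fun h0 => h (congrArg Fin.val h0)
    have h2 : ¬ j = i := fun h0 => h h0.symm
    simp [matE, h1, h2]

theorem matF_mulVec_single {j : ℕ} (hj : j < n) :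
    (matF ħ n).mulVec (Pi.single ⟨j, by omega⟩ 1) =
      qNumber ħ (j + 1) • Pi.single ⟨j + 1, by omega⟩ 1 := by
  rw [Matrix.mulVec_single_one]
  ext i
  by_cases h : (i : ℕ) = j + 1
  · rw [show i = ⟨j + 1, by omega⟩ from Fin.ext h]
    simp [matF]
  · have h1 : i ≠ ⟨j + 1, by omega⟩ := fun h0 => h (congrArg Fin.val h0)
    simp [matF, h, h1]

theorem matF_mulVec_single_last : (matF ħ n).mulVec (Pi.single (Fin.last n) 1) = 0 := by
  rw [Matrix.mulVec_single_one]
  ext i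
  have : (i : ℕ) ≠ n + 1 := by omega
  simp [matF, this]

theorem matH_mulVec_single (j : Fin (n + 1)) : (matH ħ n k ε).mulVec (Pi.single j 1) =
    ((n : ℂ) - 2 * (j : ℕ) + shift ħ k ε) • Pi.single j 1 := by
  rw [matH, Matrix.diagonal_mulVec_single, ← Pi.single_smul', smul_eq_mul]

end Matrices

/-! ### Irreducibility and pairwise inequivalence -/

theorem repT_isIrreducible {ħ : ℂ} (hq : ∀ m : ℕ, m ≠ 0 → Complex.exp ħ ^ m ≠ 1) (n : ℕ) (k : ℤ)
    (ε : ℤˣ) : IsIrreducible (repT ħ (sinh_ne_zero hq) n k ε) := by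
  obtain ⟨hE, hF, -⟩ := repT_spec ħ (sinh_ne_zero hq) n k ε
  refine ⟨inferInstance, fun W hW => or_iff_not_imp_left.2 fun hbot => ?_⟩
  have hWE : ∀ v ∈ W, (matE ħ n ε).mulVec v ∈ W := fun v hv => by
    have := hW (genE ħ) v hv
    rwa [hE, matOp_apply] at this
  have hWF : ∀ v ∈ W, (matF ħ n).mulVec v ∈ W := fun v hv => by
    have := hW (genF ħ) v hv
    rwa [hF, matOp_apply] at this
  have hε : ((ε : ℤ) : ℂ) ≠ 0 := by exact_mod_cast ε.ne_zero
  -- Induction on a bound `j` for the support: if coordinate `j + 1` is nonzero, `E` moves it to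
  -- position `j` with a nonzero factor and the result is supported in `0, …, j`.
  have lower : ∀ j : ℕ, ∀ v ∈ W, v ≠ 0 → (∀ i : Fin (n + 1), j < i → v i = 0) →
      Pi.single 0 1 ∈ W := by
    intro j
    induction j with
    | zero =>
      intro v hv hv0 hj
      have h1 : v = v 0 • Pi.single 0 1 := by
        ext i
        by_cases hi : i = 0
        · simp [hi]
        · rw [hj i (Nat.pos_of_ne_zero fun h => hi (Fin.ext h))]
          simp [hi]
      have h2 : v 0 ≠ 0 := fun h => hv0 (by rw [h1, h, zero_smul])
      exact (W.smul_mem_iff h2).1 (h1 ▸ hv)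
    | succ j ih =>
      intro v hv hv0 hj
      by_cases h0 : ∀ i : Fin (n + 1), (i : ℕ) = j + 1 → v i = 0
      · exact ih v hv hv0 fun i hi => (Nat.lt_or_eq_of_le (Nat.succ_le_of_lt hi)).elim (hj i)
          fun h => h0 i h.symm
      · push Not at h0
        obtain ⟨i, hi, hvi⟩ := h0
        have hjn : j < n := by omega
        rw [show i = ⟨j + 1, by omega⟩ from Fin.ext hi] at hvi
        refine ih _ (hWE v hv) (fun h => ?_) fun i hi => ?_
        · have h1 := congrFun h ⟨j, by omega⟩
          rw [matE_mulVec_of_lt ħ n ε v hjn] at h1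
          exact mul_ne_zero (mul_ne_zero hε (qNumber_ne_zero hq (by omega))) hvi h1
        · rcases Nat.lt_or_eq_of_le (Fin.is_le i) with h | h
          · have := matE_mulVec_of_lt ħ n ε v h
            rw [hj _ (Nat.succ_lt_succ hi), mul_zero] at this
            exact this
          · obtain rfl : i = Fin.last n := Fin.ext h
            exact matE_mulVec_last ħ n ε v
  obtain ⟨v, hv, hv0⟩ := W.ne_bot_iff.1 hbot
  have hzero := lower n v hv hv0 fun i hi => absurd hi (by omega)
  have hall : ∀ j : ℕ, ∀ hj : j < n + 1, Pi.single (⟨j, hj⟩ : Fin (n + 1)) (1 : ℂ) ∈ W := by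
    intro j
    induction j with
    | zero => exact fun _ => hzero
    | succ j ih =>
      intro hj
      have := hWF _ (ih (by omega))
      rw [matF_mulVec_single ħ n (by omega)] at this
      exact (W.smul_mem_iff (qNumber_ne_zero hq (by omega))).1 this
  rw [eq_top_iff, ← (Pi.basisFun ℂ (Fin (n + 1))).span_eq, Submodule.span_le]
  rintro _ ⟨j, rfl⟩
  rw [Pi.basisFun_apply]
  exact hall j j.2

/-- Both shifts are integer multiples of `πi/ħ`; the parity of the integer recovers `ε`, and its
half recovers `k`. -/
theorem shift_injective {ħ : ℂ} (hħ : ħ ≠ 0) {k k' : ℤ} {ε ε' : ℤˣ}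
    (h : shift ħ k ε = shift ħ k' ε') : k = k' ∧ ε = ε' := by
  have hπ : (Real.pi : ℂ) ≠ 0 := by exact_mod_cast Real.pi_ne_zero
  have hc : (Real.pi : ℂ) * ħ⁻¹ * Complex.I ≠ 0 :=
    mul_ne_zero (mul_ne_zero hπ (inv_ne_zero hħ)) Complex.I_ne_zero
  have key : ∀ a b : ℤ, (a : ℂ) * Real.pi * ħ⁻¹ * Complex.I = b * Real.pi * ħ⁻¹ * Complex.I →
      a = b := by
    intro a b hab
    have h1 : (a : ℂ) = b := mul_right_cancel₀ hc (by linear_combination hab)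
    exact_mod_cast h1
  have hs : ∀ (k : ℤ) (ε : ℤˣ), shift ħ k ε =
      ((2 * k + if ε = 1 then 0 else 1 : ℤ) : ℂ) * Real.pi * ħ⁻¹ * Complex.I := by
    intro k ε
    by_cases hε : ε = 1 <;> simp [shift, hε]
  rw [hs, hs] at h
  have h1 := key _ _ h
  rcases Int.units_eq_one_or ε with rfl | rfl <;> rcases Int.units_eq_one_or ε' with rfl | rfl <;>
    simp at h1 ⊢ <;> omega

theorem eq_of_equivalent_repT {ħ : ℂ} (hq : ∀ m : ℕ, m ≠ 0 → Complex.exp ħ ^ m ≠ 1) {n n' : ℕ}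
    {k k' : ℤ} {ε ε' : ℤˣ} (h : Equivalent (repT ħ (sinh_ne_zero hq) n k ε)
      (repT ħ (sinh_ne_zero hq) n' k' ε')) : n = n' ∧ k = k' ∧ ε = ε' := by
  have hħ : ħ ≠ 0 := by
    rintro rfl
    exact hq 1 one_ne_zero (by simp)
  obtain ⟨S, hS⟩ := h
  have hn : n = n' := by simpa using S.toLinearEquiv.finrank_eq
  subst hn
  obtain ⟨hE, -, hH⟩ := repT_spec ħ (sinh_ne_zero hq) n k ε
  obtain ⟨hE', -, hH'⟩ := repT_spec ħ (sinh_ne_zero hq) n k' ε'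
  have h1 := hS (genE ħ) (Pi.single 0 1)
  have h2 := hS (genH ħ) (Pi.single 0 1)
  rw [hE, hE', matOp_apply, matOp_apply, matE_mulVec_single_zero, map_zero] at h1
  rw [hH, hH', matOp_apply, matOp_apply, matH_mulVec_single, map_smul] at h2
  set y := S (Pi.single 0 1) with hy
  have hε : ((ε' : ℤ) : ℂ) ≠ 0 := by exact_mod_cast ε'.ne_zero
  -- Since `E` kills `y`, all its coordinates past the zeroth vanish, so `y 0 = 0` would contradict
  -- injectivity of `S`.
  have hy0 : y 0 ≠ 0 := by
    intro h0
    have hy' : y = 0 := by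
      ext ⟨i, hi⟩
      cases i with
      | zero => exact h0
      | succ i =>
        have h3 := matE_mulVec_of_lt ħ n ε' y (i := i) (by omega)
        rw [← h1, Pi.zero_apply, eq_comm] at h3
        exact (mul_eq_zero.1 h3).resolve_left
          (mul_ne_zero hε (qNumber_ne_zero hq (by omega)))
    have h4 := S.map_eq_zero_iff.1 hy'
    simpa using congrFun h4 0
  have h3 := congrFun h2 0
  rw [matH, Matrix.mulVec_diagonal, Pi.smul_apply, smul_eq_mul] at h3
  exact ⟨rfl, shift_injective hħ (add_left_cancel (mul_right_cancel₀ hy0 h3))⟩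

/-! ### The module generated by a highest weight vector -/

section HighestWeight

variable {V : Type*} [NormedAddCommGroup V] [NormedSpace ℂ V]

/-- The vectors `f ^ j w / [j]_q!`. -/
def dividedPowerVec (ħ : ℂ) (f : V →L[ℂ] V) (w : V) (j : ℕ) : V :=
  (∏ i ∈ Finset.range j, qNumber ħ (i + 1))⁻¹ • (f ^ j) w

theorem dividedPowerVec_zero (ħ : ℂ) (f : V →L[ℂ] V) (w : V) : dividedPowerVec ħ f w 0 = w := by
  simp [dividedPowerVec]

theorem apply_dividedPowerVec {ħ : ℂ} (hq : ∀ m : ℕ, m ≠ 0 → Complex.exp ħ ^ m ≠ 1)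
    (f : V →L[ℂ] V) (w : V) (j : ℕ) :
    f (dividedPowerVec ħ f w j) = qNumber ħ (j + 1) • dividedPowerVec ħ f w (j + 1) := by
  have h1 : qNumber ħ (j + 1) ≠ 0 := qNumber_ne_zero hq (by omega)
  rw [dividedPowerVec, dividedPowerVec, map_smul, smul_smul, Finset.prod_range_succ, mul_inv,
    mul_left_comm, mul_inv_cancel₀ h1, mul_one, pow_succ']
  rfl

variable {ħ : ℂ} {e f h : V →L[ℂ] V} {w : V}

theorem IsTriple.h_apply_dividedPowerVec (t : IsTriple ħ e f h) {c : ℂ} (hw : h w = c • w)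
    (j : ℕ) : h (dividedPowerVec ħ f w j) = (c - 2 * j) • dividedPowerVec ħ f w j := by
  have h1 := DFunLike.congr_fun (commutator_pow t.comm_h_f j) w
  have h2 : h ((f ^ j) w) - (f ^ j) (h w) = ((j : ℂ) * (-2)) • (f ^ j) w := h1
  rw [hw, map_smul, sub_eq_iff_eq_add, ← add_smul] at h2
  rw [dividedPowerVec, map_smul, h2, smul_comm]
  congr 1
  ring

variable [CompleteSpace V]

/-- `T - c` kills `w`, so only the constant term of the series of `exp (T - c)` acts on it. -/
theorem exp_apply_eq_smul {T : V →L[ℂ] V} {c : ℂ} (hw : T w = c • w) :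
    NormedSpace.exp T w = Complex.exp c • w := by
  have h1 : NormedSpace.exp (T + (-c) • (1 : V →L[ℂ] V)) w = w := by
    have h2 : (T + (-c) • (1 : V →L[ℂ] V)) w = 0 := by
      change T w + (-c) • w = 0
      rw [hw, neg_smul, add_neg_cancel]
    have h3 := (NormedSpace.exp_series_hasSum_exp' (𝕂 := ℂ)
      (T + (-c) • (1 : V →L[ℂ] V))).mapL (ContinuousLinearMap.apply ℂ V w)
    refine h3.unique ?_
    convert hasSum_single (0 : ℕ) ?_ using 1
    · simp
    · intro m hm
      obtain ⟨m, rfl⟩ := Nat.exists_eq_succ_of_ne_zero hm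
      rw [ContinuousLinearMap.apply_apply, pow_succ]
      change (m.succ.factorial : ℂ)⁻¹ • ((T + (-c) • (1 : V →L[ℂ] V)) ^ m) ((T + (-c) • (1 : V →L[ℂ] V)) w) = 0
      rw [h2, map_zero, smul_zero]
  rw [exp_add_smul_one, smul_apply] at h1
  rw [← h1, smul_smul, ← Complex.exp_add, add_neg_cancel, Complex.exp_zero, one_smul, h1]

/-- On a weight vector of weight `c` the bracket in `IsTriple.commutator_e_pow_f` becomes the scalar
`2 sinh (ħ (c - j))`, and `sinh_add_shift` turns the shift in `c` into the sign `ε`. The divided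
power normalization absorbs `[j+1]_q`. -/
theorem IsTriple.e_apply_dividedPowerVec_succ
    (hq : ∀ m : ℕ, m ≠ 0 → Complex.exp ħ ^ m ≠ 1) (t : IsTriple ħ e f h) {n : ℕ} {k : ℤ} {ε : ℤˣ}
    (he : e w = 0) (hw : h w = ((n : ℂ) + shift ħ k ε) • w) (j : ℕ) :
    e (dividedPowerVec ħ f w (j + 1)) =
      (((ε : ℤ) : ℂ) * qNumber ħ ((n : ℤ) - j)) • dividedPowerVec ħ f w j := by
  have hħ := sinh_ne_zero hq
  set c := (n : ℂ) + shift ħ k ε with hc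
  have h1 := DFunLike.congr_fun (t.commutator_e_pow_f hħ j) w
  have h2 : e ((f ^ (j + 1)) w) - (f ^ (j + 1)) (e w) =
      ((2 * Complex.sinh ħ)⁻¹ * qNumber ħ (j + 1)) • (f ^ j)
        (Complex.exp (-(j * ħ)) • NormedSpace.exp (ħ • h) w -
          Complex.exp (j * ħ) • NormedSpace.exp ((-ħ) • h) w) := h1
  have hexp : ∀ s : ℂ, NormedSpace.exp (s • h) w = Complex.exp (s * c) • w := fun s =>
    exp_apply_eq_smul (by rw [smul_apply, hw, smul_smul])
  have h3 : Complex.exp (-(j * ħ)) * Complex.exp (ħ * c) -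
      Complex.exp (j * ħ) * Complex.exp (-ħ * c) =
      2 * Complex.sinh ħ * (((ε : ℤ) : ℂ) * qNumber ħ ((n : ℤ) - j)) := by
    have h4 := sinh_add_shift ħ hħ k ε (n - j)
    have h5 : ħ * ((n : ℂ) - j + shift ħ k ε) = -(j * ħ) + ħ * c := by rw [hc]; ring
    rw [h5, Complex.sinh] at h4
    rw [qNumber_eq, ← Complex.exp_add, ← Complex.exp_add]
    push_cast
    rw [show (j : ℂ) * ħ + -ħ * c = -(-(j * ħ) + ħ * c) by ring]
    have h6 : ∀ x : ℂ, 2 * Complex.sinh ħ * (((ε : ℤ) : ℂ) * (x / Complex.sinh ħ)) =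
        2 * (((ε : ℤ) : ℂ) * x) := fun x => by field_simp
    rw [h6]
    linear_combination 2 * h4
  rw [he, map_zero, sub_zero, hexp, hexp, smul_smul, smul_smul, ← sub_smul, h3, map_smul,
    smul_smul] at h2
  have h6 : qNumber ħ (j + 1) ≠ 0 := qNumber_ne_zero hq (by omega)
  rw [dividedPowerVec, dividedPowerVec, map_smul, h2, smul_smul, smul_smul,
    Finset.prod_range_succ, mul_inv]
  congr 1
  field_simp

/-- The linear map `ℂ^(n+1) → V` that sends the standard basis to the vectors
`f ^ j w / [j]_q!`. -/
def highestWeightMap (ħ : ℂ) (f : V →L[ℂ] V) (w : V) (n : ℕ) : (Fin (n + 1) → ℂ) →L[ℂ] V :=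
  LinearMap.toContinuousLinearMap
    (Fintype.linearCombination ℂ fun j : Fin (n + 1) => dividedPowerVec ħ f w j)

omit [CompleteSpace V] in
theorem highestWeightMap_single (ħ : ℂ) (f : V →L[ℂ] V) (w : V) (n : ℕ) (j : Fin (n + 1)) :
    highestWeightMap ħ f w n (Pi.single j 1) = dividedPowerVec ħ f w j := by
  simp [highestWeightMap, Fintype.linearCombination_apply_single]

omit [CompleteSpace V] in
theorem intertwines_of_single {n : ℕ} {S : (Fin (n + 1) → ℂ) →L[ℂ] V}
    {M : Matrix (Fin (n + 1)) (Fin (n + 1)) ℂ} {x : V →L[ℂ] V}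
    (hS : ∀ j, S (M.mulVec (Pi.single j 1)) = x (S (Pi.single j 1))) (v : Fin (n + 1) → ℂ) :
    S (matOp n M v) = x (S v) := by
  suffices hs : (S.comp (matOp n M)).toLinearMap = (x.comp S).toLinearMap from
    DFunLike.congr_fun hs v
  refine (Pi.basisFun ℂ (Fin (n + 1))).ext fun j => ?_
  rw [Pi.basisFun_apply]
  exact hS j

end HighestWeight

/-! ### Classification of irreducible representations -/

theorem IsIrreducible.equivalent_repT {ħ : ℂ} (hq : ∀ m : ℕ, m ≠ 0 → Complex.exp ħ ^ m ≠ 1)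
    {V : Type*} [NormedAddCommGroup V] [NormedSpace ℂ V] [CompleteSpace V] {ρ : BanachRep ħ V}
    (hρ : IsIrreducible ρ) : FiniteDimensional ℂ V ∧ ∃ (n : ℕ) (k : ℤ) (ε : ℤˣ),
      Equivalent ρ (repT ħ (sinh_ne_zero hq) n k ε) := by
  have := hρ.1
  have t : IsTriple ħ (ρ (genE ħ)) (ρ (genF ħ)) (ρ (genH ħ)) :=
    (isTriple_USl2 ħ).map (ρ : USl2 ħ →ₐ[ℂ] (V →L[ℂ] V)) ρ.cont
  obtain ⟨n, k, ε, w, hw0, hew, hfw, hhw⟩ := t.exists_highest_weight hq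
  set S := highestWeightMap ħ (ρ (genF ħ)) w n with hSdef
  obtain ⟨hE, hF, hH⟩ := repT_spec ħ (sinh_ne_zero hq) n k ε
  have hS : ∀ a v, S (repT ħ (sinh_ne_zero hq) n k ε a v) = ρ a (S v) := by
    refine intertwines_of_generators _ _ S ?_ ?_ ?_
    · rw [hE]
      refine intertwines_of_single fun j => ?_
      obtain ⟨j, hj⟩ := j
      cases j with
      | zero =>
        have h0 : (⟨0, hj⟩ : Fin (n + 1)) = 0 := rfl
        rw [h0, matE_mulVec_single_zero, map_zero, highestWeightMap_single]
        simp [dividedPowerVec_zero, hew]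
      | succ j =>
        rw [matE_mulVec_single_succ ħ n ε (by omega), map_smul, highestWeightMap_single,
          highestWeightMap_single, t.e_apply_dividedPowerVec_succ hq hew hhw]
    · rw [hF]
      refine intertwines_of_single fun j => ?_
      rcases Nat.lt_or_eq_of_le (Fin.is_le j) with hj | hj
      · rw [show j = ⟨(j : ℕ), by omega⟩ from rfl, matF_mulVec_single ħ n hj, map_smul,
          highestWeightMap_single, highestWeightMap_single, apply_dividedPowerVec hq]
      -- The chain of vectors stops at `e_n` precisely because `f ^ (n + 1)` kills `w`.
      · rw [show j = Fin.last n from Fin.ext hj, matF_mulVec_single_last, map_zero,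
          highestWeightMap_single, apply_dividedPowerVec hq, Fin.val_last, dividedPowerVec, hfw,
          smul_zero, smul_zero]
    · rw [hH]
      refine intertwines_of_single fun j => ?_
      rw [matH_mulVec_single, map_smul, highestWeightMap_single, t.h_apply_dividedPowerVec hhw]
      congr 1
      ring
  have hS0 : S ≠ 0 := by
    intro h0
    refine hw0 ?_
    have h1 := highestWeightMap_single ħ (ρ (genF ħ)) w n 0
    rw [← hSdef, h0] at h1
    simpa [dividedPowerVec_zero] using h1.symm
  have hbij := bijective_of_intertwines (repT_isIrreducible hq n k ε) hρ hS0 hS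
  -- The inverse is continuous automatically, as the source `ℂ^(n+1)` is finite dimensional.
  let L := (LinearEquiv.ofBijective S.toLinearMap hbij).toContinuousLinearEquiv
  have hL : ∀ v, L v = S v := fun _ => rfl
  refine ⟨L.toLinearEquiv.finiteDimensional, n, k, ε, L.symm, fun a v => ?_⟩
  rw [ContinuousLinearEquiv.symm_apply_eq, hL, hS, ← hL, L.apply_symm_apply]

end AnalyticSl2

end

theorem theorem2p8 (ħ : ℂ) (hq : ∀ m : ℕ, m ≠ 0 → Complex.exp ħ ^ m ≠ 1) :
    (∀ (n : ℕ) (k : ℤ) (ε : ℤˣ),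
      AnalyticSl2.IsIrreducible (AnalyticSl2.repT ħ (AnalyticSl2.sinh_ne_zero hq) n k ε)) ∧
    (∀ (n n' : ℕ) (k k' : ℤ) (ε ε' : ℤˣ),
      AnalyticSl2.Equivalent (AnalyticSl2.repT ħ (AnalyticSl2.sinh_ne_zero hq) n k ε)
        (AnalyticSl2.repT ħ (AnalyticSl2.sinh_ne_zero hq) n' k' ε') →
      n = n' ∧ k = k' ∧ ε = ε') ∧
    (∀ (V : Type*) [NormedAddCommGroup V] [NormedSpace ℂ V] [CompleteSpace V]
      (ρ : AnalyticSl2.BanachRep ħ V), AnalyticSl2.IsIrreducible ρ →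
      FiniteDimensional ℂ V ∧
      ∃ (n : ℕ) (k : ℤ) (ε : ℤˣ),
        AnalyticSl2.Equivalent ρ (AnalyticSl2.repT ħ (AnalyticSl2.sinh_ne_zero hq) n k ε)) :=
  ⟨AnalyticSl2.repT_isIrreducible hq, fun _ _ _ _ _ _ => AnalyticSl2.eq_of_equivalent_repT hq,
    fun _ _ _ _ _ => AnalyticSl2.IsIrreducible.equivalent_repT hq⟩
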